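/- Let $R$ be a commutative domain of characteristic $\neq 2$, let $l$ be an odd positive integer and let $q\in R$ be a primitive $l$-th root of unity. Let $m,n,r\ge 0$, let $W=\mathfrak S_r$ with length function $\ell$ relative to the basic transpositions $s_k=(k,k+1)$ (composition: $(vw)(k)=v(w(k))$), and let $\mathcal H_R$ be the Hecke algebra of $W$: the free $R$-module with basis $\{\mathcal T_w\}_{w\in W}$ and $\mathcal T_w\mathcal T_s=\mathcal T_{ws}$ if $\ell(ws)>\ell(w)$, $\mathcal T_w\mathcal T_s=(q-q^{-1})\mathcal T_w+\mathcal T_{ws}$ otherwise; put $T_w=q^{\ell(w)}\mathcal T_w$. Let $V=V_R(m|n)$ be free with basis $v_1,\dots,v_{m+n}$, with parity $\hat i=0$ for $i\le m$ and $\hat i=1$ for $i>m$. For $\mathbf i\in\{1,\dots,m+n\}^r$ put $v_{\mathbf i}=v_{i_1}\otimes\cdots\otimes v_{i_r}$ and $\mathbf i w=(i_{w(1)},\dots,i_{w(r)})$. Then $V^{\otimes r}$ is a right $\mathcal H_R$-module by: $v_{\mathbf i}\mathcal T_{s_k}$ equals $(-1)^{\hat i_k\hat i_{k+1}}v_{\mathbf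 i s_k}$ if $i_k<i_{k+1}$; $q v_{\mathbf i}$ if $i_k=i_{k+1}\le m$; $-q^{-1}v_{\mathbf i}$ if $i_k=i_{k+1}>m$; $(-1)^{\hat i_k\hat i_{k+1}}v_{\mathbf i s_k}+(q-q^{-1})v_{\mathbf i}$ if $i_k>i_{k+1}$. Functions are written on the right. Let $\Lambda(m|n,r)$ be the set of compositions $\lambda=(\lambda^{(0)}|\lambda^{(1)})$ of $r$ into $m$ even followed by $n$ odd parts, $\mathbf i_\lambda=(1^{\lambda_1},2^{\lambda_2},\dots)$ (with $i$ occurring $\lambda_i$ times), $W_\lambda=W_{\lambda^{(0)}}\times W_{\lambda^{(1)}}$ the Young subgroup with its even and odd parts, $\mathcal D_\lambda$ the set of shortest representatives of the right cosets of $W_\lambda$, $\mathcal D_{\lambda\mu}=\mathcal D_\lambda\cap\mathcal D_\mu^{-1}$, and, with $P^d=d^{-1}Pd$, $$\mathcal D^\circ_{\lambda\mu}=\{d\in\mathcal D_{\lambda\mu}: W_{\lambda^{(0)}}^d\cap W_{\mu^{(1)}}=1=W_{\lambda^{(1)}}^d\cap W_{\mu^{(0)}}\}.$$ Write $W_\nu=W_{\lambda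 d\cap\mu}=W_\lambda^d\cap W_\mu$, let $\mathcal D_\nu$ be the set of shortest representatives of the right cosets of $W_\nu$, let $e_{\mu,\lambda d}\in\operatorname{End}_R(V^{\otimes r})$ send $v_{\mathbf i_\mu}$ to $v_{\mathbf i_\lambda d}$ and all other $v_{\mathbf i}$ to $0$, and let $$N^d_{\mu\lambda}=N_{W,W_{\lambda d\cap\mu}}(e_{\mu,\lambda d})=\sum_{w\in\mathcal D_\nu}\mathcal T_{w^{-1}}\,e_{\mu,\lambda d}\,\mathcal T_w .$$ Let $x_{\lambda^{(0)}}=\sum_{w\in W_{\lambda^{(0)}}}T_w$, $y_{\lambda^{(1)}}=\sum_{w\in W_{\lambda^{(1)}}}(-q^2)^{-\ell(w)}T_w$ and $\mathfrak T=\bigoplus_{\lambda\in\Lambda(m|n,r)}x_{\lambda^{(0)}}y_{\lambda^{(1)}}\mathcal H_R$; the $q$-Schur superalgebra is $\mathcal S_R(m|n,r)=\operatorname{End}_{\mathcal H_R}(\mathfrak T)$. For $d\in\mathcal D_\lambda$ let $\hat d$ be the number of pairs $k<k'$ such that the $k$-th entry of $\mathbf i_\lambda d$ is larger than the $k'$-th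 and both are odd. **Theorem.** 1. Each $N^d_{\mu\lambda}$ $(\lambda,\mu\in\Lambda(m|n,r),\ d\in\mathcal D^\circ_{\lambda\mu})$ lies in $\operatorname{End}_{\mathcal H_R}(V^{\otimes r})$, and the family of all of them is an $R$-basis of $\operatorname{End}_{\mathcal H_R}(V^{\otimes r})$. 2. There is an isomorphism of right $\mathcal H_R$-modules $f:V^{\otimes r}\to\mathfrak T$ with $((-1)^{\hat d}v_{\mathbf i_\lambda d})f=x_{\lambda^{(0)}}y_{\lambda^{(1)}}\mathcal T_d$ for all $\lambda\in\Lambda(m|n,r)$ and $d\in\mathcal D_\lambda$. It identifies $\operatorname{End}_{\mathcal H_R}(V^{\otimes r})$ with $\mathcal S_R(m|n,r)$, so that the $N^d_{\mu\lambda}$ form a basis of $\mathcal S_R(m|n,r)$. 3. For $\lambda,\mu\in\Lambda(m|n,r)$ and $d\in\mathcal D^\circ_{\lambda\mu}$ there is $\psi^d_{\mu\lambda}\in\mathcal S_R(m|n,r)$ such that, for all $\alpha\in\Lambda(m|n,r)$ and $h\in\mathcal H_R$, $$(x_{\alpha^{(0)}}y_{\alpha^{(1)}}h)\psi^d_{\mu\lambda}=\delta_{\mu\alpha}\sum(-q^2)^{-\ell(w_1)}x_{\lambda^{(0)}}y_{\lambda^{(1)}}T_dT_{w_0}T_{w_1}h,$$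 the sum being over $w_0\in W_{\mu^{(0)}}$, $w_1\in W_{\mu^{(1)}}$ with $w_0w_1\in\mathcal D_\nu$. Moreover $N^d_{\mu\lambda}=q^{-\ell(d)}(-1)^{\hat d}\,f\,\psi^d_{\mu\lambda}\,f^{-1}$, and the $\psi^d_{\mu\lambda}$ form an $R$-basis of $\mathcal S_R(m|n,r)$. -/

import Mathlib

open scoped TensorProduct

noncomputable section

namespace QSchurSuper

/-! ### The symmetric group on `r` letters as a Coxeter group

Permutations are composed as functions, `(v * w) k = v (w k)`. The letters are `0, …, r - 1`. -/

/-- The symmetric group `W = 𝔖_r`. -/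
abbrev W (r : ℕ) : Type := Equiv.Perm (Fin r)

/-- The letter `k`, where `k` indexes a basic transposition. -/
def lo {r : ℕ} (k : Fin (r - 1)) : Fin r := ⟨k, by omega⟩

/-- The letter `k + 1`, where `k` indexes a basic transposition. -/
def hi {r : ℕ} (k : Fin (r - 1)) : Fin r := ⟨k + 1, by omega⟩

/-- The basic transposition `s_k = (k, k + 1)`. -/
def s {r : ℕ} (k : Fin (r - 1)) : W r := Equiv.swap (lo k) (hi k)

/-- The product of a word in the basic transpositions. -/
def wordProd {r : ℕ} (l : List (Fin (r - 1))) : W r := (l.map s).prod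

/-- The length function with respect to the basic transpositions. -/
def len {r : ℕ} (w : W r) : ℕ :=
  sInf {n : ℕ | ∃ l : List (Fin (r - 1)), l.length = n ∧ wordProd l = w}

/-- The inversions of `w`, recorded by values; an auxiliary notion. -/
def invSet {r : ℕ} (w : W r) : Finset (Fin r × Fin r) :=
  Finset.univ.filter fun p => p.1 < p.2 ∧ w⁻¹ p.2 < w⁻¹ p.1

theorem lo_lt_hi {r : ℕ} (k : Fin (r - 1)) : lo k < hi k := by
  simp [lo, hi, Fin.lt_def]

theorem s_mul_s {r : ℕ} (k : Fin (r - 1)) : s k * s k = 1 := Equiv.swap_mul_self _ _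

theorem s_inv {r : ℕ} (k : Fin (r - 1)) : (s k)⁻¹ = s k := Equiv.swap_inv _ _

theorem s_lo {r : ℕ} (k : Fin (r - 1)) : s k (lo k) = hi k := Equiv.swap_apply_left _ _

theorem s_hi {r : ℕ} (k : Fin (r - 1)) : s k (hi k) = lo k := Equiv.swap_apply_right _ _

theorem mul_s_mul_s {r : ℕ} (w : W r) (k : Fin (r - 1)) : w * s k * s k = w := by
  rw [mul_assoc, s_mul_s, mul_one]

theorem s_lt_s {r : ℕ} (k : Fin (r - 1)) (a b : Fin r) (hab : ¬ (a = lo k ∧ b = hi k))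
    (hba : ¬ (a = hi k ∧ b = lo k)) : s k a < s k b ↔ a < b := by
  unfold s lo hi at *
  simp only [Equiv.swap_apply_def]
  simp only [Fin.ext_iff, Fin.lt_def] at *
  split_ifs <;> simp_all <;> omega

theorem lt_hi_lo_or {r : ℕ} (w : W r) (k : Fin (r - 1)) : w (lo k) < w (hi k) ∨
    w (hi k) < w (lo k) := by
  rcases lt_trichotomy (w (lo k)) (w (hi k)) with h | h | h
  · exact Or.inl h
  · exact absurd (w.injective h) (lo_lt_hi k).ne
  · exact Or.inr h

theorem inv_apply_self' {r : ℕ} (w : W r) (a : Fin r) : w⁻¹ (w a) = a := w.symm_apply_apply a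

theorem invSet_mul_s {r : ℕ} (w : W r) (k : Fin (r - 1)) (h : w (lo k) < w (hi k)) :
    (w (lo k), w (hi k)) ∉ invSet w ∧
      invSet (w * s k) = insert (w (lo k), w (hi k)) (invSet w) := by
  have h1 := lo_lt_hi k
  refine ⟨by simp [invSet, h1.le], ?_⟩
  ext ⟨x, y⟩
  obtain ⟨a, rfl⟩ := w.surjective x
  obtain ⟨b, rfl⟩ := w.surjective y
  simp only [invSet, Finset.mem_filter, Finset.mem_univ, true_and, Finset.mem_insert, mul_inv_rev,
    Equiv.Perm.mul_apply, inv_apply_self', s_inv, Prod.mk.injEq,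
    EmbeddingLike.apply_eq_iff_eq]
  by_cases c1 : a = lo k ∧ b = hi k
  · obtain ⟨rfl, rfl⟩ := c1
    simp [s_lo, s_hi, h1, h]
  by_cases c2 : a = hi k ∧ b = lo k
  · obtain ⟨rfl, rfl⟩ := c2
    simp [s_lo, s_hi, h.le, h1.ne']
  rw [s_lt_s k b a (by tauto) (by tauto)]
  simp [c1]

theorem card_invSet_asc {r : ℕ} (w : W r) (k : Fin (r - 1)) (h : w (lo k) < w (hi k)) :
    (invSet (w * s k)).card = (invSet w).card + 1 := by
  obtain ⟨h1, h2⟩ := invSet_mul_s w k h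
  rw [h2, Finset.card_insert_of_notMem h1]

theorem card_invSet_desc {r : ℕ} (w : W r) (k : Fin (r - 1)) (h : w (hi k) < w (lo k)) :
    (invSet (w * s k)).card + 1 = (invSet w).card := by
  rw [← card_invSet_asc (w * s k) k (by simpa [s_lo, s_hi] using h), mul_s_mul_s]

theorem exists_desc {r : ℕ} (w : W r) (hw : w ≠ 1) : ∃ k : Fin (r - 1), w (hi k) < w (lo k) := by
  by_contra hcon
  have hasc : ∀ k : Fin (r - 1), w (lo k) < w (hi k) := fun k =>
    (lt_hi_lo_or w k).resolve_right fun h => hcon ⟨k, h⟩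
  apply hw
  have hm : StrictMono w := by
    cases r with
    | zero => exact fun a => a.elim0
    | succ r =>
      rw [Fin.strictMono_iff_lt_succ]
      exact fun i => hasc i
  ext i
  have := Subsingleton.elim (StrictMono.orderIsoOfSurjective w hm w.surjective) (OrderIso.refl _)
  have h2 := congrArg (fun f => f i) this
  simp at h2
  simp [h2]

theorem wordProd_append {r : ℕ} (l : List (Fin (r - 1))) (k : Fin (r - 1)) :
    wordProd (l ++ [k]) = wordProd l * s k := by
  simp [wordProd]

theorem card_invSet_le {r : ℕ} (l : List (Fin (r - 1))) :
    (invSet (wordProd l)).card ≤ l.length := by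
  induction l using List.reverseRecOn with
  | nil =>
    have : invSet (wordProd ([] : List (Fin (r - 1)))) = ∅ := by
      ext ⟨x, y⟩
      simp [invSet, wordProd]
      intro h; exact h.le
    simp [this]
  | append_singleton l k ih =>
    rw [wordProd_append, List.length_append, List.length_singleton]
    rcases lt_hi_lo_or (wordProd l) k with h | h
    · rw [card_invSet_asc _ _ h]; omega
    · have := card_invSet_desc _ _ h; omega

theorem exists_word {r : ℕ} (w : W r) :
    ∃ l : List (Fin (r - 1)), l.length = (invSet w).card ∧ wordProd l = w := by
  generalize hn : (invSet w).card = n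
  induction n generalizing w with
  | zero =>
    refine ⟨[], rfl, ?_⟩
    by_contra hw
    obtain ⟨k, hk⟩ := exists_desc w (fun h => hw (by simp [wordProd, h]))
    have := card_invSet_desc w k hk
    omega
  | succ n ih =>
    have hw : w ≠ 1 := by
      rintro rfl
      have := card_invSet_le (r := r) []
      simp only [wordProd, List.map_nil, List.prod_nil, List.length_nil] at this
      omega
    obtain ⟨k, hk⟩ := exists_desc w hw
    have := card_invSet_desc w k hk
    obtain ⟨l, h1, h2⟩ := ih (w * s k) (by omega)
    exact ⟨l ++ [k], by simp [h1], by rw [wordProd_append, h2, mul_s_mul_s]⟩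

theorem len_eq {r : ℕ} (w : W r) : len w = (invSet w).card := by
  apply le_antisymm
  · exact Nat.sInf_le (exists_word w)
  · obtain ⟨l, h1, h2⟩ := Nat.sInf_mem (s := {n : ℕ | ∃ l : List (Fin (r - 1)), l.length = n ∧
      wordProd l = w}) ⟨_, exists_word w⟩
    unfold len
    rw [← h1, ← h2]
    exact card_invSet_le l

theorem len_lt_iff {r : ℕ} (w : W r) (k : Fin (r - 1)) :
    len w < len (w * s k) ↔ w (lo k) < w (hi k) := by
  rw [len_eq, len_eq]
  rcases lt_hi_lo_or w k with h | h
  · simp [card_invSet_asc w k h, h]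
  · have := card_invSet_desc w k h
    simp only [h.not_gt, iff_false]
    omega

/-- A reduced expression of `w`. -/
def reducedWord {r : ℕ} (w : W r) : List (Fin (r - 1)) := (exists_word w).choose

theorem reducedWord_length {r : ℕ} (w : W r) : (reducedWord w).length = len w := by
  rw [len_eq]; exact (exists_word w).choose_spec.1

theorem reducedWord_prod {r : ℕ} (w : W r) : wordProd (reducedWord w) = w :=
  (exists_word w).choose_spec.2

theorem reduced_append {r : ℕ} (l : List (Fin (r - 1))) (k : Fin (r - 1))
    (h : (l ++ [k]).length = len (wordProd (l ++ [k]))) :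
    l.length = len (wordProd l) ∧ wordProd l (lo k) < wordProd l (hi k) := by
  rw [wordProd_append, len_eq] at h
  rw [len_eq]
  have h1 := card_invSet_le l
  simp only [List.length_append, List.length_singleton] at h
  rcases lt_hi_lo_or (wordProd l) k with h2 | h2
  · rw [card_invSet_asc _ _ h2] at h
    exact ⟨by omega, h2⟩
  · have := card_invSet_desc _ _ h2
    omega

/-! ### The Hecke algebra -/

/-- Right descents. -/
def desc {r : ℕ} (w : W r) (k : Fin (r - 1)) : Prop := w (hi k) < w (lo k)

instance {r : ℕ} (w : W r) (k : Fin (r - 1)) : Decidable (desc w k) := by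
  unfold desc; infer_instance

theorem not_desc {r : ℕ} (w : W r) (k : Fin (r - 1)) :
    ¬ desc w k ↔ w (lo k) < w (hi k) := by
  unfold desc
  rcases lt_hi_lo_or w k with h | h
  · simp [h, h.le]
  · simp [h, h.le]

theorem desc_mul_s {r : ℕ} (w : W r) (k : Fin (r - 1)) : desc (w * s k) k ↔ ¬ desc w k := by
  rw [not_desc]; simp [desc, s_lo, s_hi]

/-- The operator attached to a word, when operators are applied in the order of the letters. -/
def rword {R M : Type*} [CommRing R] [AddCommGroup M] [Module R M] {r : ℕ}
    (A : Fin (r - 1) → Module.End R M) (l : List (Fin (r - 1))) : Module.End R M :=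
  (l.reverse.map A).prod

theorem rword_append {R M : Type*} [CommRing R] [AddCommGroup M] [Module R M] {r : ℕ}
    (A : Fin (r - 1) → Module.End R M) (l : List (Fin (r - 1))) (k : Fin (r - 1)) :
    rword A (l ++ [k]) = A k * rword A l := by
  simp [rword]

/-- The underlying `R`-module of the Hecke algebra `H_R(𝔖_r)` with parameter `q`: the free
`R`-module on `W`, an element being given by its coefficients in the basis `T w`. The multiplication
is characterised by `T_mul_T_s` below. -/
def Hecke {R : Type*} [CommRing R] (_q : Rˣ) (r : ℕ) : Type _ := W r → R

section HeckeAlgebra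

variable {R : Type*} [CommRing R] (q : Rˣ) (r : ℕ)

instance : AddCommGroup (Hecke q r) := inferInstanceAs (AddCommGroup (W r → R))

instance : Module R (Hecke q r) := inferInstanceAs (Module R (W r → R))

variable {r}

/-- The basis element `𝒯_w`, in the normalisation `(𝒯_s - q) (𝒯_s + q⁻¹) = 0`. -/
def T (w : W r) : Hecke q r := (Pi.single w 1 : W r → R)

/-- `q - q⁻¹`. -/
def qdiff : R := (q : R) - ((q⁻¹ : Rˣ) : R)

/-- Right multiplication by `𝒯_{s_k}`. -/
def rightOp (k : Fin (r - 1)) : Module.End R (Hecke q r) where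
  toFun h := fun u : W r => h (u * s k) + if desc u k then qdiff q * h u else 0
  map_add' h h' := by
    funext u
    change (h (u * s k) + h' (u * s k)) + (if desc u k then qdiff q * (h u + h' u) else 0) =
      (h (u * s k) + _) + (h' (u * s k) + _)
    split_ifs <;> ring
  map_smul' a h := by
    funext u
    change (a * h (u * s k)) + (if desc u k then qdiff q * (a * h u) else 0) =
      a * (h (u * s k) + _)
    split_ifs <;> ring

/-- Left multiplication by `𝒯_{s_k}`. -/
def leftOp (k : Fin (r - 1)) : Module.End R (Hecke q r) where
  toFun h := fun u : W r => h (s k * u) + if desc u⁻¹ k then qdiff q * h u else 0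
  map_add' h h' := by
    funext u
    change (h (s k * u) + h' (s k * u)) + (if desc u⁻¹ k then qdiff q * (h u + h' u) else 0) =
      (h (s k * u) + _) + (h' (s k * u) + _)
    split_ifs <;> ring
  map_smul' a h := by
    funext u
    change (a * h (s k * u)) + (if desc u⁻¹ k then qdiff q * (a * h u) else 0) =
      a * (h (s k * u) + _)
    split_ifs <;> ring

theorem rightOp_apply (k : Fin (r - 1)) (h : Hecke q r) (u : W r) :
    rightOp q k h u = h (u * s k) + if desc u k then qdiff q * h u else 0 := rfl

theorem leftOp_apply (k : Fin (r - 1)) (h : Hecke q r) (u : W r) :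
    leftOp q k h u = h (s k * u) + if desc u⁻¹ k then qdiff q * h u else 0 := rfl

theorem desc_s_mul (u : W r) (j k : Fin (r - 1)) (h : s j * u ≠ u * s k) :
    desc (s j * u) k ↔ desc u k := by
  have h0 : s j = Equiv.swap (lo j) (hi j) := rfl
  have h1 : ¬ (u (hi k) = lo j ∧ u (lo k) = hi j) := by
    rintro ⟨a, b⟩
    apply h
    have := Equiv.mul_swap_eq_swap_mul u (lo k) (hi k)
    rw [a, b, Equiv.swap_comm (hi j)] at this
    exact this.symm
  have h2 : ¬ (u (hi k) = hi j ∧ u (lo k) = lo j) := by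
    rintro ⟨a, b⟩
    apply h
    have := Equiv.mul_swap_eq_swap_mul u (lo k) (hi k)
    rw [a, b] at this
    exact this.symm
  exact s_lt_s j _ _ h1 h2

theorem left_right_comm (j k : Fin (r - 1)) (h : Hecke q r) :
    leftOp q j (rightOp q k h) = rightOp q k (leftOp q j h) := by
  funext u
  simp only [leftOp_apply, rightOp_apply, mul_assoc]
  by_cases hc : s j * u = u * s k
  · have hinv : u⁻¹ * s j = s k * u⁻¹ := by
      rw [inv_mul_eq_iff_eq_mul, ← mul_assoc, ← hc, mul_assoc]; simp
    have e1 : desc u⁻¹ j ↔ desc u k := by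
      have a : u (lo k) = s j (u (hi k)) := by
        rw [← Equiv.Perm.mul_apply, hc, Equiv.Perm.mul_apply, s_hi]
      have b : u (hi k) = s j (u (lo k)) := by
        rw [← Equiv.Perm.mul_apply, hc, Equiv.Perm.mul_apply, s_lo]
      have c := (lo_lt_hi k).ne
      have d : u (lo k) ≠ u (hi k) := fun h => c (u.injective h)
      have key : (u (lo k) = lo j ∧ u (hi k) = hi j) ∨ (u (lo k) = hi j ∧ u (hi k) = lo j) := by
        by_cases h1 : u (hi k) = lo j
        · right; rw [h1, s_lo] at a; exact ⟨a, h1⟩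
        by_cases h2 : u (hi k) = hi j
        · left; rw [h2, s_hi] at a; exact ⟨a, h2⟩
        · exact absurd (a.trans (Equiv.swap_apply_of_ne_of_ne h1 h2)) d
      unfold desc
      rcases key with ⟨h1, h2⟩ | ⟨h1, h2⟩
      · have h1' : u⁻¹ (lo j) = lo k := by rw [← h1]; exact u.symm_apply_apply _
        have h2' : u⁻¹ (hi j) = hi k := by rw [← h2]; exact u.symm_apply_apply _
        rw [h1, h2, h1', h2']
        exact iff_of_false (lo_lt_hi _).not_gt (lo_lt_hi _).not_gt
      · have h1' : u⁻¹ (hi j) = lo k := by rw [← h1]; exact u.symm_apply_apply _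
        have h2' : u⁻¹ (lo j) = hi k := by rw [← h2]; exact u.symm_apply_apply _
        rw [h1, h2, h1', h2']
        simp [lo_lt_hi]
    have e2 : desc (u * s k) k ↔ ¬ desc u k := desc_mul_s u k
    have e3 : desc (u * s k)⁻¹ j ↔ ¬ desc u k := by
      rw [← hc, mul_inv_rev, s_inv, desc_mul_s, e1]
    simp only [e1, e2, e3, hc]
  · have e1 := desc_s_mul u j k hc
    have e2 : desc (u * s k)⁻¹ j ↔ desc u⁻¹ j := by
      rw [mul_inv_rev, s_inv]
      apply desc_s_mul
      intro h
      apply hc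
      have h' : u * (s k * u⁻¹) * u = u * (u⁻¹ * s j) * u := by rw [h]
      simpa [mul_assoc] using h'.symm
    simp only [e1, e2]
    by_cases hd : desc u k <;> by_cases hd' : desc u⁻¹ j <;> simp [hd, hd'] <;> ring

theorem rightOp_T (k : Fin (r - 1)) (w : W r) :
    rightOp q k (T q w) = T q (w * s k) + if desc w k then qdiff q • T q w else 0 := by
  funext u
  rw [rightOp_apply]
  have h1 : T q w (u * s k) = T q (w * s k) u := by
    simp only [T, Pi.single_apply]
    congr 1
    apply propext
    constructor
    · rintro rfl; rw [mul_s_mul_s]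
    · rintro rfl; rw [mul_s_mul_s]
  rw [h1]
  by_cases hu : u = w
  · subst hu
    split_ifs <;> rfl
  · have h2 : T q w u = 0 := by simp [T, hu]
    rw [h2]
    have h3 : (if desc w k then qdiff q • T q w else (0 : Hecke q r)) u = 0 := by
      by_cases hd : desc w k
      · rw [if_pos hd]; change qdiff q * T q w u = 0; rw [h2, mul_zero]
      · rw [if_neg hd]; rfl
    change _ = T q (w * s k) u + (if desc w k then qdiff q • T q w else (0 : Hecke q r)) u
    rw [h3]
    simp

theorem leftOp_T (k : Fin (r - 1)) (w : W r) :
    leftOp q k (T q w) = T q (s k * w) + if desc w⁻¹ k then qdiff q • T q w else 0 := by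
  funext u
  rw [leftOp_apply]
  have h1 : T q w (s k * u) = T q (s k * w) u := by
    simp only [T, Pi.single_apply]
    congr 1
    apply propext
    constructor
    · rintro rfl; rw [← mul_assoc, s_mul_s, one_mul]
    · rintro rfl; rw [← mul_assoc, s_mul_s, one_mul]
  rw [h1]
  by_cases hu : u = w
  · subst hu
    split_ifs <;> rfl
  · have h2 : T q w u = 0 := by simp [T, hu]
    rw [h2]
    have h3 : (if desc w⁻¹ k then qdiff q • T q w else (0 : Hecke q r)) u = 0 := by
      by_cases hd : desc w⁻¹ k
      · rw [if_pos hd]; change qdiff q * T q w u = 0; rw [h2, mul_zero]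
      · rw [if_neg hd]; rfl
    change _ = T q (s k * w) u + (if desc w⁻¹ k then qdiff q • T q w else (0 : Hecke q r)) u
    rw [h3]
    simp

/-- The basis `(𝒯_w)` of the Hecke algebra. -/
def basisT : Module.Basis (W r) R (Hecke q r) := Pi.basisFun R (W r)

theorem basisT_apply (w : W r) : basisT q w = T q w := Pi.basisFun_apply R (W r) w

theorem sum_T (h : Hecke q r) : ∑ w, h w • T q w = h := by
  have := (basisT q).sum_repr h
  simp only [basisT_apply] at this
  exact this

/-- Right multiplication by `h`. -/
def mulRight (h : Hecke q r) : Module.End R (Hecke q r) :=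
  ∑ w, h w • rword (rightOp q) (reducedWord w)

theorem rword_T_one (l : List (Fin (r - 1))) (hl : l.length = len (wordProd l)) :
    rword (rightOp q) l (T q 1) = T q (wordProd l) := by
  induction l using List.reverseRecOn with
  | nil => simp [rword, wordProd]
  | append_singleton l k ih =>
    obtain ⟨h1, h2⟩ := reduced_append l k hl
    rw [rword_append, Module.End.mul_apply, ih h1, rightOp_T, wordProd_append,
      if_neg ((not_desc _ _).2 h2), add_zero]

theorem rword_reducedWord_T_one (w : W r) :
    rword (rightOp q) (reducedWord w) (T q 1) = T q w := by
  rw [rword_T_one q _ (by rw [reducedWord_length, reducedWord_prod]), reducedWord_prod]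

theorem mulRight_T_one (h : Hecke q r) : mulRight q h (T q 1) = h := by
  simp only [mulRight, LinearMap.sum_apply, LinearMap.smul_apply, rword_reducedWord_T_one]
  exact sum_T q h

theorem leftOp_rword (j : Fin (r - 1)) (l : List (Fin (r - 1))) (h : Hecke q r) :
    leftOp q j (rword (rightOp q) l h) = rword (rightOp q) l (leftOp q j h) := by
  induction l using List.reverseRecOn with
  | nil => simp [rword]
  | append_singleton l k ih =>
    rw [rword_append, Module.End.mul_apply, Module.End.mul_apply, left_right_comm, ih]

theorem leftOp_mulRight (j : Fin (r - 1)) (h x : Hecke q r) :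
    leftOp q j (mulRight q h x) = mulRight q h (leftOp q j x) := by
  simp only [mulRight, LinearMap.sum_apply, LinearMap.smul_apply, map_sum, map_smul, leftOp_rword]

/-- Operators commuting with all left multiplications are determined by their value at `1`. -/
theorem ext_of_comm (F G : Module.End R (Hecke q r))
    (hF : ∀ j x, leftOp q j (F x) = F (leftOp q j x))
    (hG : ∀ j x, leftOp q j (G x) = G (leftOp q j x)) (h1 : F (T q 1) = G (T q 1)) : F = G := by
  have key : ∀ l : List (Fin (r - 1)), F (T q (wordProd l)) = G (T q (wordProd l)) := by
    intro l
    induction l with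
    | nil => simpa [wordProd] using h1
    | cons k l ih =>
      have e : T q (wordProd (k :: l)) = leftOp q k (T q (wordProd l)) -
          (if desc (wordProd l)⁻¹ k then qdiff q else 0) • T q (wordProd l) := by
        rw [leftOp_T]
        have : wordProd (k :: l) = s k * wordProd l := by simp [wordProd]
        rw [this]
        split_ifs <;> simp
      rw [e, map_sub, map_sub, map_smul, map_smul, ← hF, ← hG, ih]
  refine (basisT q).ext fun w => ?_
  rw [basisT_apply, ← reducedWord_prod w]
  exact key _

instance : Mul (Hecke q r) := ⟨fun x h => mulRight q h x⟩

instance : One (Hecke q r) := ⟨T q 1⟩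

theorem mul_def (x h : Hecke q r) : x * h = mulRight q h x := rfl

theorem one_def : (1 : Hecke q r) = T q 1 := rfl

theorem mulRight_mul (h h' : Hecke q r) : mulRight q (h * h') = mulRight q h' * mulRight q h := by
  apply ext_of_comm
  · intro j x; exact leftOp_mulRight q j _ x
  · intro j x; simp only [Module.End.mul_apply, leftOp_mulRight]
  · rw [Module.End.mul_apply, mulRight_T_one, mulRight_T_one, mul_def]

theorem mulRight_one : mulRight q (T q (1 : W r)) = 1 := by
  apply ext_of_comm
  · intro j x; exact leftOp_mulRight q j _ x
  · intro j x; rfl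
  · rw [mulRight_T_one]; rfl

theorem mulRight_add (h h' : Hecke q r) : mulRight q (h + h') = mulRight q h + mulRight q h' := by
  simp only [mulRight, ← Finset.sum_add_distrib]
  exact Finset.sum_congr rfl fun w _ => add_smul (h w) (h' w) _

theorem mulRight_smul (a : R) (h : Hecke q r) : mulRight q (a • h) = a • mulRight q h := by
  simp only [mulRight, Finset.smul_sum, smul_smul]
  rfl

instance : Ring (Hecke q r) :=
  { (inferInstance : AddCommGroup (Hecke q r)),
    (inferInstance : Mul (Hecke q r)),
    (inferInstance : One (Hecke q r)) with
    left_distrib := fun a b c => by simp only [mul_def, mulRight_add, LinearMap.add_apply]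
    right_distrib := fun a b c => by simp only [mul_def, map_add]
    zero_mul := fun a => by simp only [mul_def, map_zero]
    mul_zero := fun a => by
      have h : mulRight q (0 : Hecke q r) = 0 := by
        have := mulRight_smul q 0 (0 : Hecke q r)
        rwa [zero_smul, zero_smul] at this
      simp only [mul_def, h, LinearMap.zero_apply]
    mul_assoc := fun a b c => by
      exact (congrArg (fun F : Module.End R (Hecke q r) => F a) (mulRight_mul q b c)).symm
    one_mul := fun a => mulRight_T_one q a
    mul_one := fun a => by rw [mul_def, one_def, mulRight_one]; rfl }

instance : Algebra R (Hecke q r) :=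
  Algebra.ofModule (fun a x y => by simp only [mul_def, map_smul])
    (fun a x y => by simp only [mul_def, mulRight_smul, LinearMap.smul_apply])

theorem mulRight_T_s (k : Fin (r - 1)) : mulRight q (T q (s k)) = rightOp q k := by
  apply ext_of_comm
  · intro j x; exact leftOp_mulRight q j _ x
  · intro j x; exact left_right_comm q j k x
  · rw [mulRight_T_one, rightOp_T, one_mul, if_neg, add_zero]
    rw [not_desc]; exact lo_lt_hi k

/-- The defining multiplication rule of the Hecke algebra. -/
theorem T_mul_T_s (w : W r) (k : Fin (r - 1)) :
    T q w * T q (s k) = if len w < len (w * s k) then T q (w * s k)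
      else qdiff q • T q w + T q (w * s k) := by
  rw [mul_def, mulRight_T_s, rightOp_T]
  simp only [len_lt_iff, ← not_desc]
  by_cases hd : desc w k <;> simp [hd, add_comm]

end HeckeAlgebra

/-! ### The tensor superspace -/

/-- The set `I(m|n, r)` of multi-indices; the basis vectors of the superspace are indexed by
`0, …, m + n - 1`. -/
abbrev MultiIndex (m n r : ℕ) : Type := Fin r → Fin (m + n)

/-- The basis vector with this index is odd. -/
def IsOdd {m n : ℕ} (i : Fin (m + n)) : Prop := m ≤ (i : ℕ)

instance {m n : ℕ} (i : Fin (m + n)) : Decidable (IsOdd i) := by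
  unfold IsOdd; infer_instance

/-- The `r`-th tensor power of the free module `V_R(m|n)` of rank `m + n`. -/
def TensorSpace (R : Type*) [CommRing R] (m n r : ℕ) : Type _ :=
  ⨂[R] _ : Fin r, (Fin (m + n) → R)

section Tensor

variable {R : Type*} [CommRing R] {m n r : ℕ}

instance : AddCommGroup (TensorSpace R m n r) :=
  inferInstanceAs (AddCommGroup (⨂[R] _ : Fin r, (Fin (m + n) → R)))

instance : Module R (TensorSpace R m n r) :=
  inferInstanceAs (Module R (⨂[R] _ : Fin r, (Fin (m + n) → R)))

/-- The basis of all `v_{i_1} ⊗ ⋯ ⊗ v_{i_r}`. -/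
def tensorBasis : Module.Basis (MultiIndex m n r) R (TensorSpace R m n r) :=
  Basis.piTensorProduct fun _ => Pi.basisFun R (Fin (m + n))

/-- The tensor `v_i = v_{i_1} ⊗ ⋯ ⊗ v_{i_r}`. -/
def v (i : MultiIndex m n r) : TensorSpace R m n r :=
  PiTensorProduct.tprod R fun k => (Pi.single (i k) 1 : Fin (m + n) → R)

theorem tensorBasis_apply (i : MultiIndex m n r) : tensorBasis i = (v i : TensorSpace R m n r) := by
  refine (Basis.piTensorProduct_apply _ _).trans ?_
  simp only [Pi.basisFun_apply]
  rfl

/-- The sign `(-1)^{â b̂}`, where `â` is the parity of `a`. -/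
def sgn (R : Type*) [CommRing R] (a b : Fin (m + n)) : R := if IsOdd a ∧ IsOdd b then -1 else 1

variable (q : Rˣ)

/-- The operator by which `𝒯_{s_k}` acts from the right on the tensor space; place permutation by
`w` sends `i` to `i ∘ w`. -/
def simpleAct (k : Fin (r - 1)) : Module.End R (TensorSpace R m n r) :=
  tensorBasis.constr R fun i =>
    if i (lo k) < i (hi k) then sgn R (i (lo k)) (i (hi k)) • v (i ∘ s k)
    else if i (lo k) = i (hi k) then
      if IsOdd (i (lo k)) then (-((q⁻¹ : Rˣ) : R)) • v i else (q : R) • v i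
    else sgn R (i (lo k)) (i (hi k)) • v (i ∘ s k) + qdiff q • v i

/-- The right action of `h = ∑ h_w 𝒯_w`, each `𝒯_w` acting through a reduced expression of `w`. -/
def rightAct (h : Hecke q r) : Module.End R (TensorSpace R m n r) :=
  ∑ w, h w • rword (simpleAct q) (reducedWord w)

/-- An auxiliary weight. -/
def chi (a b : Fin (m + n)) : R :=
  if a = b then (if IsOdd a then -((q⁻¹ : Rˣ) : R) else (q : R)) else sgn R a b

/-- An auxiliary coefficient. -/
def coef (j : MultiIndex m n r) (w : W r) : R := ∏ p ∈ invSet w, chi q (j p.1) (j p.2)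

theorem chi_comm (a b : Fin (m + n)) : chi q a b = chi q b a := by
  unfold chi sgn
  by_cases h : a = b
  · subst h; rfl
  · simp [h, Ne.symm h, and_comm]

theorem isUnit_chi (a b : Fin (m + n)) : IsUnit (chi q a b) := by
  unfold chi sgn
  split_ifs
  · exact (Units.isUnit _).neg
  · exact Units.isUnit _
  · exact isUnit_one.neg
  · exact isUnit_one

theorem isUnit_coef (j : MultiIndex m n r) (w : W r) : IsUnit (coef q j w) := by
  unfold coef
  exact IsUnit.prod_iff.2 fun p _ => isUnit_chi q _ _

theorem coef_asc (j : MultiIndex m n r) (w : W r) (k : Fin (r - 1)) (h : ¬ desc w k) :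
    coef q j (w * s k) = chi q (j (w (lo k))) (j (w (hi k))) * coef q j w := by
  obtain ⟨h1, h2⟩ := invSet_mul_s w k ((not_desc _ _).1 h)
  unfold coef
  rw [h2, Finset.prod_insert h1]

theorem coef_desc (j : MultiIndex m n r) (w : W r) (k : Fin (r - 1)) (h : desc w k) :
    coef q j w = chi q (j (w (lo k))) (j (w (hi k))) * coef q j (w * s k) := by
  have h1 := coef_asc q j (w * s k) k (by rw [desc_mul_s]; simpa using h)
  rw [mul_s_mul_s] at h1
  rw [h1, chi_comm]
  simp [s_lo, s_hi]

open scoped Classical in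
/-- An auxiliary embedding of the tensor space into a sum of copies of the Hecke algebra, used only
to verify that the right action is an action. -/
def emb : TensorSpace R m n r →ₗ[R] (MultiIndex m n r → Hecke q r) :=
  tensorBasis.constr R fun i j (u : W r) => if Monotone j ∧ j ∘ u = i then coef q j u else 0

open scoped Classical in
theorem emb_v (i j : MultiIndex m n r) (u : W r) :
    emb q (v i) j u = if Monotone j ∧ j ∘ u = i then coef q j u else 0 := by
  rw [← tensorBasis_apply]
  let F : MultiIndex m n r → (MultiIndex m n r → Hecke q r) :=
    fun i j (u : W r) => if Monotone j ∧ j ∘ u = i then coef q j u else 0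
  have h := (tensorBasis (R := R)).constr_basis R F i
  exact congrFun (congrFun h j) u

theorem simpleAct_v (k : Fin (r - 1)) (i : MultiIndex m n r) : simpleAct q k (v i) =
    if i (lo k) < i (hi k) then sgn R (i (lo k)) (i (hi k)) • v (i ∘ s k)
    else if i (lo k) = i (hi k) then
      if IsOdd (i (lo k)) then (-((q⁻¹ : Rˣ) : R)) • v i else (q : R) • v i
    else sgn R (i (lo k)) (i (hi k)) • v (i ∘ s k) + qdiff q • v i := by
  rw [← tensorBasis_apply, simpleAct, Module.Basis.constr_basis, tensorBasis_apply]

theorem emb_injective : Function.Injective (emb q : TensorSpace R m n r →ₗ[R] _) := by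
  classical
  rw [injective_iff_map_eq_zero]
  intro x hx
  rw [← (tensorBasis (R := R)).sum_repr x]
  refine Finset.sum_eq_zero fun i _ => ?_
  have h1 : emb q x (i ∘ Tuple.sort i) (Tuple.sort i)⁻¹ = 0 := by rw [hx]; rfl
  have hm : Monotone (i ∘ Tuple.sort i) := Tuple.monotone_sort i
  have hi : (i ∘ Tuple.sort i) ∘ ⇑(Tuple.sort i)⁻¹ = i := by
    funext a
    exact congrArg i ((Tuple.sort i).apply_symm_apply a)
  have h2 : emb q x (i ∘ Tuple.sort i) (Tuple.sort i)⁻¹ =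
      tensorBasis.repr x i * coef q (i ∘ Tuple.sort i) (Tuple.sort i)⁻¹ := by
    conv_lhs => rw [← (tensorBasis (R := R)).sum_repr x, map_sum]
    simp only [map_smul, tensorBasis_apply]
    have : ∀ (F : MultiIndex m n r → MultiIndex m n r → Hecke q r) (j : MultiIndex m n r) (u : W r),
        (∑ a, F a) j u = ∑ a, F a j u := by
      intro F j u
      rw [Finset.sum_apply]
      exact Finset.sum_apply u _ _
    rw [this, Finset.sum_eq_single i]
    · change _ * emb q (v i) _ _ = _
      rw [emb_v, if_pos ⟨hm, hi⟩]
    · intro b _ hb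
      change _ * emb q (v b) _ _ = _
      rw [emb_v, if_neg, mul_zero]
      rintro ⟨-, h⟩
      exact hb (h.symm.trans hi)
    · simp
  rw [h1] at h2
  have h3 : tensorBasis.repr x i = 0 := (isUnit_coef q _ _).mul_left_eq_zero.1 h2.symm
  rw [h3, zero_smul]

theorem sgn_mul_sgn (a b : Fin (m + n)) : sgn R a b * sgn R a b = 1 := by
  unfold sgn; split_ifs <;> ring

theorem emb_simpleAct (k : Fin (r - 1)) (x : TensorSpace R m n r) (j : MultiIndex m n r) :
    emb q (simpleAct q k x) j = rightOp q k (emb q x j) := by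
  classical
  have : (LinearMap.proj j ∘ₗ emb q) ∘ₗ simpleAct q k =
      rightOp q k ∘ₗ (LinearMap.proj j ∘ₗ emb (m := m) (n := n) q) := by
    refine tensorBasis.ext fun i => ?_
    rw [tensorBasis_apply]
    simp only [LinearMap.comp_apply, LinearMap.proj_apply]
    funext u
    rw [rightOp_apply, emb_v, emb_v]
    have e1 : j ∘ ⇑(u * s k) = i ↔ j ∘ u = i ∘ s k := by
      constructor
      · rintro rfl
        funext a
        change _ = j (u (s k (s k a)))
        rw [← Equiv.Perm.mul_apply (s k), s_mul_s]; rfl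
      · intro h
        funext a
        change (j ∘ u) (s k a) = _
        rw [h]
        change i (s k (s k a)) = i a
        rw [← Equiv.Perm.mul_apply (s k), s_mul_s]; rfl
    have es : ∀ (a : R) (z : TensorSpace R m n r), emb q (a • z) j u = a * emb q z j u := by
      intro a z; rw [map_smul]; rfl
    have ea : ∀ (y z : TensorSpace R m n r),
        emb q (y + z) j u = emb q y j u + emb q z j u := by
      intro a z; rw [map_add]; rfl
    simp only [e1]
    rw [simpleAct_v]
    by_cases hj : Monotone j
    swap
    · simp only [hj, false_and, if_false, mul_zero, ite_self, add_zero]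
      split_ifs <;> simp only [es, ea, emb_v, hj, false_and, if_false, mul_zero, add_zero]
    have hdl : desc u k → j (u (hi k)) ≤ j (u (lo k)) := fun h => hj h.le
    have hal : ¬ desc u k → j (u (lo k)) ≤ j (u (hi k)) := fun h => hj ((not_desc _ _).1 h).le
    simp only [hj, true_and]
    rcases lt_trichotomy (i (lo k)) (i (hi k)) with hlt | heq | hgt
    · rw [if_pos hlt, es, emb_v]
      simp only [hj, true_and]
      have c2 : (if desc u k then qdiff q * (if j ∘ u = i then coef q j u else 0) else 0) = 0 := by
        split_ifs with hd hiu
        · subst hiu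
          exact absurd (hdl hd) hlt.not_ge
        · simp
        · rfl
      rw [c2, add_zero]
      split_ifs with hiu
      · have a1 : j (u (lo k)) = i (hi k) := by
          have := congrFun hiu (lo k); simpa [s_lo] using this
        have a2 : j (u (hi k)) = i (lo k) := by
          have := congrFun hiu (hi k); simpa [s_hi] using this
        have hd : desc u k := by
          by_contra hd
          have := hal hd
          rw [a1, a2] at this
          exact this.not_gt hlt
        rw [coef_desc q j u k hd, a1, a2, chi_comm, chi, if_neg hlt.ne, ← mul_assoc, sgn_mul_sgn,
          one_mul]
      · simp
    · rw [if_neg heq.not_lt, if_pos heq]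
      have e2 : i ∘ s k = i := by
        funext a
        change i (s k a) = i a
        unfold s
        rw [Equiv.swap_apply_def]
        split_ifs with h1 h2
        · rw [h1, heq]
        · rw [h2, heq]
        · rfl
      rw [e2]
      have e3 : emb q (if IsOdd (i (lo k)) then (-((q⁻¹ : Rˣ) : R)) • v i else (q : R) • v i) j u =
          chi q (i (lo k)) (i (hi k)) * if j ∘ u = i then coef q j u else 0 := by
        unfold chi
        rw [if_pos heq]
        by_cases ho : IsOdd (i (lo k))
        · rw [if_pos ho, if_pos ho, es, emb_v]; simp only [hj, true_and]
        · rw [if_neg ho, if_neg ho, es, emb_v]; simp only [hj, true_and]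
      rw [e3]
      split_ifs with hiu hd
      · subst hiu
        have := coef_desc q j u k hd
        change chi q (j (u (lo k))) (j (u (hi k))) * _ = _
        have hc : chi q (j (u (lo k))) (j (u (hi k))) * chi q (j (u (lo k))) (j (u (hi k))) =
            1 + qdiff q * chi q (j (u (lo k))) (j (u (hi k))) := by
          have hq : (q : R) * ((q⁻¹ : Rˣ) : R) = 1 := q.mul_inv
          simp only [Function.comp_apply] at heq
          unfold chi qdiff
          rw [if_pos heq]
          split_ifs
          · linear_combination hq
          · linear_combination hq
        rw [this]
        linear_combination coef q j (u * s k) * hc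
      · subst hiu
        rw [coef_asc q j u k hd, add_zero]
        rfl
      · simp
      · simp
    · rw [if_neg hgt.not_gt, if_neg hgt.ne', ea, es, es, emb_v, emb_v]
      simp only [hj, true_and]
      congr 1
      · split_ifs with hiu
        · have a1 : j (u (lo k)) = i (hi k) := by
            have := congrFun hiu (lo k); simpa [s_lo] using this
          have a2 : j (u (hi k)) = i (lo k) := by
            have := congrFun hiu (hi k); simpa [s_hi] using this
          have hd : ¬ desc u k := by
            intro hd
            have := hdl hd
            rw [a1, a2] at this
            exact this.not_gt hgt
          rw [coef_asc q j u k hd, a1, a2, chi_comm, chi, if_neg hgt.ne']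
        · simp
      · split_ifs with hiu hd hd
        · rfl
        · subst hiu
          exact absurd (hal hd) hgt.not_ge
        · simp
        · simp
  exact LinearMap.congr_fun this x

theorem emb_rword (l : List (Fin (r - 1))) (x : TensorSpace R m n r) (j : MultiIndex m n r) :
    emb q (rword (simpleAct q) l x) j = rword (rightOp q) l (emb q x j) := by
  induction l using List.reverseRecOn with
  | nil => simp [rword]
  | append_singleton l k ih =>
    rw [rword_append, rword_append, Module.End.mul_apply, Module.End.mul_apply, emb_simpleAct, ih]

theorem emb_rightAct (h : Hecke q r) (x : TensorSpace R m n r) (j : MultiIndex m n r) :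
    emb q (rightAct q h x) j = emb q x j * h := by
  simp only [mul_def, mulRight, rightAct, LinearMap.sum_apply, LinearMap.smul_apply, map_sum,
    map_smul, Finset.sum_apply, Pi.smul_apply, emb_rword]

/-- The right action as a homomorphism from the opposite of the Hecke algebra. -/
def rightActHom : (Hecke q r)ᵐᵒᵖ →ₐ[R] Module.End R (TensorSpace R m n r) where
  toFun h := rightAct q h.unop
  map_one' := by
    refine LinearMap.ext fun x => emb_injective q (funext fun j => ?_)
    rw [emb_rightAct, MulOpposite.unop_one, mul_one]; rfl
  map_mul' a b := by
    refine LinearMap.ext fun x => emb_injective q (funext fun j => ?_)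
    rw [emb_rightAct, Module.End.mul_apply, emb_rightAct, emb_rightAct, MulOpposite.unop_mul,
      mul_assoc]
  map_zero' := by
    refine LinearMap.ext fun x => emb_injective q (funext fun j => ?_)
    rw [emb_rightAct, MulOpposite.unop_zero, mul_zero, LinearMap.zero_apply, map_zero]; rfl
  map_add' a b := by
    refine LinearMap.ext fun x => emb_injective q (funext fun j => ?_)
    rw [emb_rightAct, MulOpposite.unop_add, mul_add, LinearMap.add_apply, map_add, Pi.add_apply,
      emb_rightAct, emb_rightAct]
  commutes' a := by
    refine LinearMap.ext fun x => emb_injective q (funext fun j => ?_)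
    rw [emb_rightAct, MulOpposite.algebraMap_apply, MulOpposite.unop_op,
      Module.algebraMap_end_apply, map_smul, Pi.smul_apply, ← Algebra.commutes, ← Algebra.smul_def]

instance : Module (Hecke q r)ᵐᵒᵖ (TensorSpace R m n r) :=
  Module.compHom _ (rightActHom (m := m) (n := n) q).toRingHom

theorem op_smul_def (h : Hecke q r) (x : TensorSpace R m n r) :
    MulOpposite.op h • x = rightAct q h x := rfl

instance : IsScalarTower R (Hecke q r)ᵐᵒᵖ (TensorSpace R m n r) where
  smul_assoc a h x := by
    change rightActHom q (a • h) x = a • rightActHom q h x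
    rw [map_smul]; rfl

/-- The right action of `𝒯_{s_k}` on the tensor space. -/
theorem v_smul_T_s (k : Fin (r - 1)) (i : MultiIndex m n r) :
    MulOpposite.op (T q (s k)) • (v i : TensorSpace R m n r) =
    if i (lo k) < i (hi k) then sgn R (i (lo k)) (i (hi k)) • v (i ∘ s k)
    else if i (lo k) = i (hi k) then
      if IsOdd (i (lo k)) then (-((q⁻¹ : Rˣ) : R)) • v i else (q : R) • v i
    else sgn R (i (lo k)) (i (hi k)) • v (i ∘ s k) + qdiff q • v i := by
  rw [← simpleAct_v]
  refine emb_injective q (funext fun j => ?_)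
  rw [op_smul_def, emb_rightAct, emb_simpleAct, mul_def, mulRight_T_s]

end Tensor

/-! ### Compositions and parabolic subgroups -/

/-- The set `Λ(m|n, r)` of compositions of `r` into `m` even parts, followed by `n` odd parts. -/
def Composition (m n r : ℕ) : Type := {lam : Fin (m + n) → ℕ // ∑ i, lam i = r}

instance {m n r : ℕ} : DecidableEq (Composition m n r) :=
  inferInstanceAs (DecidableEq {lam : Fin (m + n) → ℕ // ∑ i, lam i = r})

section Parabolic

variable {m n r : ℕ}

/-- The multi-index `i_λ = (1, …, 1, 2, …, 2, …)`, in which `i` occurs `λ_i` times: it sends a letter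
to the number of the block of `λ` that contains it, the blocks being consecutive intervals. -/
def iOf (lam : Composition m n r) : MultiIndex m n r := fun k =>
  (finSigmaFinEquiv.symm (finCongr lam.2.symm k)).1

/-- The block of number `i` is the interval between the corresponding partial sums of `λ`. -/
theorem iOf_eq_iff (lam : Composition m n r) (k : Fin r) (i : Fin (m + n)) :
    iOf lam k = i ↔ ∑ j ∈ Finset.Iio i, lam.1 j ≤ (k : ℕ) ∧
      (k : ℕ) < ∑ j ∈ Finset.Iic i, lam.1 j := by
  have hsum : ∀ i : Fin (m + n), ∑ j ∈ Finset.Iic i, lam.1 j =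
      ∑ j ∈ Finset.Iio i, lam.1 j + lam.1 i := by
    intro i
    rw [← Finset.Iio_insert, Finset.sum_insert (by simp), add_comm]
  have hmono : ∀ a b : Fin (m + n), a < b →
      ∑ j ∈ Finset.Iic a, lam.1 j ≤ ∑ j ∈ Finset.Iio b, lam.1 j := by
    intro a b hab
    refine Finset.sum_le_sum_of_subset fun x hx => ?_
    rw [Finset.mem_Iic] at hx
    exact Finset.mem_Iio.2 (hx.trans_lt hab)
  have key : ∑ j ∈ Finset.Iio (iOf lam k), lam.1 j ≤ (k : ℕ) ∧
      (k : ℕ) < ∑ j ∈ Finset.Iic (iOf lam k), lam.1 j := by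
    set p := finSigmaFinEquiv.symm (finCongr lam.2.symm k) with hp
    have h1 : (k : ℕ) = (finSigmaFinEquiv p : ℕ) := by rw [hp, Equiv.apply_symm_apply]; rfl
    have h2 : ∑ j ∈ Finset.Iio p.1, lam.1 j =
        ∑ j : Fin (p.1 : ℕ), lam.1 (Fin.castLE p.1.isLt.le j) := by
      symm
      refine Finset.sum_nbij (fun j => Fin.castLE p.1.isLt.le j) ?_ ?_ ?_ ?_
      · intro j _
        rw [Finset.mem_Iio, Fin.lt_def]
        exact j.isLt
      · intro x _ y _ h
        simpa [Fin.ext_iff] using h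
      · intro x hx
        have hx' : x < p.1 := by simpa using hx
        exact ⟨⟨x, hx'⟩, by simp, rfl⟩
      · intro j _; rfl
    change ∑ j ∈ Finset.Iio p.1, lam.1 j ≤ (k : ℕ) ∧ (k : ℕ) < ∑ j ∈ Finset.Iic p.1, lam.1 j
    rw [hsum, h1, finSigmaFinEquiv_apply, h2]
    exact ⟨Nat.le_add_right _ _, Nat.add_lt_add_left p.2.isLt _⟩
  constructor
  · rintro rfl; exact key
  · rintro ⟨h1, h2⟩
    rcases lt_trichotomy (iOf lam k) i with h | h | h
    · have := hmono _ _ h; omega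
    · exact h
    · have := hmono _ _ h; omega

/-- The Young subgroup `W_λ`: the permutations leaving every block of `λ` invariant. -/
def young (lam : Composition m n r) : Subgroup (W r) where
  carrier := {w | ∀ k, iOf lam (w k) = iOf lam k}
  one_mem' _ := rfl
  mul_mem' {a b} ha hb k := (ha (b k)).trans (hb k)
  inv_mem' {a} ha k := by
    have h := ha (a⁻¹ k)
    exact h.symm.trans (congrArg (iOf lam) (a.apply_symm_apply k))

/-- The even part of `W_λ`: its elements move only letters in even blocks. -/
def youngEven (lam : Composition m n r) : Subgroup (W r) where
  carrier := {w | w ∈ young lam ∧ ∀ k, IsOdd (iOf lam k) → w k = k}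
  one_mem' := ⟨one_mem _, fun _ _ => rfl⟩
  mul_mem' {a b} ha hb := ⟨mul_mem ha.1 hb.1, fun k hk => by
    rw [Equiv.Perm.mul_apply, hb.2 k hk, ha.2 k hk]⟩
  inv_mem' {a} ha := ⟨inv_mem ha.1, fun k hk => by
    rw [Equiv.Perm.inv_eq_iff_eq, ha.2 k hk]⟩

/-- The odd part of `W_λ`: its elements move only letters in odd blocks. -/
def youngOdd (lam : Composition m n r) : Subgroup (W r) where
  carrier := {w | w ∈ young lam ∧ ∀ k, ¬ IsOdd (iOf lam k) → w k = k}
  one_mem' := ⟨one_mem _, fun _ _ => rfl⟩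
  mul_mem' {a b} ha hb := ⟨mul_mem ha.1 hb.1, fun k hk => by
    rw [Equiv.Perm.mul_apply, hb.2 k hk, ha.2 k hk]⟩
  inv_mem' {a} ha := ⟨inv_mem ha.1, fun k hk => by
    rw [Equiv.Perm.inv_eq_iff_eq, ha.2 k hk]⟩

/-- The conjugate subgroup `P^d = d⁻¹ P d`. -/
def conjBy (P : Subgroup (W r)) (d : W r) : Subgroup (W r) :=
  P.map (MulAut.conj d⁻¹).toMonoidHom

/-- The shortest representatives of the right cosets `P w`. -/
def distinguished (P : Subgroup (W r)) : Set (W r) := {w | ∀ u ∈ P, len w ≤ len (u * w)}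

/-- The set `D_{λμ} = D_λ ∩ D_μ⁻¹` of distinguished double coset representatives. -/
def doubleReps (lam mu : Composition m n r) : Set (W r) :=
  {d | d ∈ distinguished (young lam) ∧ d⁻¹ ∈ distinguished (young mu)}

/-- The set `D°_{λμ}` of those `d` in `D_{λμ}` that have the even-odd trivial intersection
property. -/
def doubleRepsCirc (lam mu : Composition m n r) : Set (W r) :=
  {d | d ∈ doubleReps lam mu ∧ conjBy (youngEven lam) d ⊓ youngOdd mu = ⊥ ∧
    conjBy (youngOdd lam) d ⊓ youngEven mu = ⊥}

/-- The subgroup `W_{λd∩μ} = W_λ^d ∩ W_μ`. -/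
def youngInter (lam mu : Composition m n r) (d : W r) : Subgroup (W r) :=
  conjBy (young lam) d ⊓ young mu

end Parabolic

/-- The triples `(λ, μ, d)` with `λ, μ ∈ Λ(m|n, r)` and `d ∈ D°_{λμ}`. -/
structure Triple (m n r : ℕ) where
  lam : Composition m n r
  mu : Composition m n r
  d : W r
  mem : d ∈ doubleRepsCirc lam mu

/-! ### Relative norms of matrix units -/

section Norms

variable {R : Type*} [CommRing R] (q : Rˣ) {m n r : ℕ}

open scoped Classical in
/-- The relative norm `N_{P,Q}(b) = ∑ 𝒯_{w⁻¹} b 𝒯_w`, summed over `w ∈ D_Q ∩ P`, for `b` in the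
bimodule `End_R(M)` of a right module `M` over the Hecke algebra. Functions being written on the
right, the bimodule structure is `(x) (g b h) = ((x g) b) h`. -/
def relNorm {M : Type*} [AddCommGroup M] [Module R M] [Module (Hecke q r)ᵐᵒᵖ M]
    [IsScalarTower R (Hecke q r)ᵐᵒᵖ M] (P Q : Subgroup (W r)) (b : Module.End R M) :
    Module.End R M :=
  ∑ w : W r with w ∈ distinguished Q ∧ w ∈ P,
    Algebra.lsmul R R M (MulOpposite.op (T q w)) ∘ₗ b ∘ₗ
      Algebra.lsmul R R M (MulOpposite.op (T q w⁻¹))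

/-- The matrix unit `e_{i,j}`, sending `v_i` to `v_j` and all other basis vectors to `0`. -/
def matrixUnit (R : Type*) [CommRing R] (i j : MultiIndex m n r) :
    Module.End R (TensorSpace R m n r) :=
  tensorBasis.constr R fun i' => if i' = i then v j else 0

/-- The relative norm `N^d_{μλ} = N_{W, W_{λd∩μ}}(e_{μ,λd})`, where `e_{μ,λd}` is the matrix unit
for `(i_μ, i_λ d)`. -/
def normElt (t : Triple m n r) : Module.End R (TensorSpace R m n r) :=
  relNorm q ⊤ (youngInter t.lam t.mu t.d) (matrixUnit R (iOf t.mu) (iOf t.lam ∘ t.d))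

/-! ### Signed `q`-permutation modules -/

/-- The element `T_w = q^{ℓ(w)} 𝒯_w`. -/
def T' (w : W r) : Hecke q r := (q : R) ^ len w • T q w

open scoped Classical in
/-- `x_{λ⁽⁰⁾}`. -/
def xElt (lam : Composition m n r) : Hecke q r := ∑ w : W r with w ∈ youngEven lam, T' q w

open scoped Classical in
/-- `y_{λ⁽¹⁾}`. -/
def yElt (lam : Composition m n r) : Hecke q r :=
  ∑ w : W r with w ∈ youngOdd lam, (((-q ^ 2)⁻¹ ^ len w : Rˣ) : R) • T' q w

/-- The signed `q`-permutation module `x_{λ⁽⁰⁾} y_{λ⁽¹⁾} H_R`, a right ideal of `H_R`. -/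
abbrev SignedPerm (lam : Composition m n r) : Submodule (Hecke q r)ᵐᵒᵖ (Hecke q r) :=
  Submodule.span (Hecke q r)ᵐᵒᵖ {xElt q lam * yElt q lam}

/-- The element `x_{λ⁽⁰⁾} y_{λ⁽¹⁾} h` of the signed `q`-permutation module. -/
def signedElt (lam : Composition m n r) (h : Hecke q r) : SignedPerm q lam :=
  ⟨xElt q lam * yElt q lam * h,
    Submodule.smul_mem _ (MulOpposite.op h) (Submodule.mem_span_singleton_self _)⟩

variable (m n r) in
/-- The direct sum of all signed `q`-permutation modules. -/
abbrev SignedTensor : Type _ := DirectSum (Composition m n r) fun lam => SignedPerm q lam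

/-- The element `x_{λ⁽⁰⁾} y_{λ⁽¹⁾} h` of the direct sum, in the summand of `λ`. -/
def signedOf (lam : Composition m n r) (h : Hecke q r) : SignedTensor q m n r :=
  DirectSum.of (fun lam => SignedPerm q lam) lam (signedElt q lam h)

open scoped Classical in
/-- The element `T_{W_λ d W_μ} = ∑ (-q²)^{-ℓ(w₁)} x_{λ⁽⁰⁾} y_{λ⁽¹⁾} T_d T_{w₀} T_{w₁}`, summed over
`w₀ ∈ W_{μ⁽⁰⁾}` and `w₁ ∈ W_{μ⁽¹⁾}` with `w₀ w₁ ∈ D_ν`, where `W_ν = W_{λd∩μ}`. -/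
def doubleCosetElt (lam mu : Composition m n r) (d : W r) : SignedTensor q m n r :=
  ∑ w : W r × W r with w.1 ∈ youngEven mu ∧ w.2 ∈ youngOdd mu ∧
      w.1 * w.2 ∈ distinguished (youngInter lam mu d),
    (((-q ^ 2)⁻¹ ^ len w.2 : Rˣ) : R) • signedOf q lam (T' q d * T' q w.1 * T' q w.2)

/-- The sign `(-1)^{î}`: the exponent counts the pairs `k < l` with `i_k > i_l`, both odd. For
`i = i_λ d` it is `(-1)^{d̂}`. -/
def oddSign (R : Type*) [CommRing R] (i : MultiIndex m n r) : R :=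
  (-1) ^ (Finset.univ.filter fun p : Fin r × Fin r =>
    p.1 < p.2 ∧ i p.2 < i p.1 ∧ IsOdd (i p.1) ∧ IsOdd (i p.2)).card

end Norms

end QSchurSuper

end

/-! The `v_{i_μ}` generate the tensor space over the Hecke algebra (`span_v_iOf`), so an
endomorphism `F` is known from the vectors `F(v_{i_μ})`. For a basic transposition `s` in `W_μ`,
`𝒯_s` multiplies `v_{i_μ}` by `q` or `-q⁻¹`, according to the parity of the block, and therefore
acts on `F(v_{i_μ})` by the same scalar. Comparing coefficients, those of `F(v_{i_μ})` are
controlled by the indices that increase weakly on each block of `μ`, which are the `i_λ d` with `d ∈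
𝒟_{λμ}`. If such an index repeats an entry inside a block of the opposite parity, the eigenvalues
`q` and `-q⁻¹` clash and the coefficient vanishes. What survives is indexed by `𝒟°_{λμ}`
(`tripleCoeff_injective`). The clash needs `q ≠ -q⁻¹`: otherwise `q² = -1`, and the odd order of `q`
would give `1 = -1`.

Conversely, the relative norm of an endomorphism commuting with a parabolic subalgebra commutes with
the whole algebra (`relNorm_op_T_s_smul`), and the parity condition in `𝒟°_{λμ}` makes the matrix
unit commute with the subalgebra of `W_ν`. The coordinates of the norms are Kronecker deltas
(`tripleCoeff_relNormHom`), so the norms form the basis dual to these coordinates.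

For the comparison with the signed permutation modules, the components of `emb` at the indices `i_λ`
send `v_{i_λ}` to `x_{λ⁽⁰⁾} y_{λ⁽¹⁾}` (`emb_v_iOf`) and assemble to an isomorphism. The `ψ` are the
norms conjugated by it and rescaled by units.

The combinatorics rests on one device: `W_λ`, its even part and `W_ν` are stabilisers of monotone
maps `g`, shortest coset representatives are the permutations whose inverse increases on the fibres
of `g`, and inversion sets of products split accordingly. -/

noncomputable section

namespace QSchurSuper

/-! ### Stabilisers of monotone maps, shortest coset representatives and inversions -/

section Fibres

variable {r : ℕ} {α : Type*} [LinearOrder α]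

/-- Without a descent at neighbouring places between `a` and `b`, `f` would increase weakly there.
This moves a failure of monotonicity to a basic transposition. -/
theorem exists_adjacent_descent (f : Fin r → α) {a b : Fin r} (hab : a < b) (h : f b < f a) :
    ∃ k : Fin (r - 1), a ≤ lo k ∧ hi k ≤ b ∧ f (hi k) < f (lo k) := by
  by_contra! hcon
  have key : ∀ n : ℕ, ∀ hn : a.1 + n < r, a.1 + n ≤ b.1 → f a ≤ f ⟨a.1 + n, hn⟩ := by
    intro n
    induction n with
    | zero => intro _ _; exact le_rfl
    | succ n ih =>
      intro hn hb
      refine (ih (by omega) (by omega)).trans ?_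
      exact hcon ⟨a.1 + n, by omega⟩ (by simp [lo, Fin.le_def])
        (by simp only [hi, Fin.le_def]; omega)
  have h1 := key (b.1 - a.1) (by omega) (by omega)
  have h2 : (⟨a.1 + (b.1 - a.1), by omega⟩ : Fin r) = b := Fin.ext (by simp only; omega)
  rw [h2] at h1
  exact h1.not_gt h

/-- The inverse of `w` is increasing on the fibres of `g`. -/
def FibreIncr {α : Type*} (g : Fin r → α) (w : W r) : Prop :=
  ∀ a b, a < b → g a = g b → w⁻¹ a < w⁻¹ b

theorem FibreIncr.lt_iff {α : Type*} {g : Fin r → α} {w : W r} (hw : FibreIncr g w) {a b : Fin r}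
    (h : g a = g b) : w⁻¹ a < w⁻¹ b ↔ a < b := by
  rcases lt_trichotomy a b with hab | rfl | hab
  · exact iff_of_true (hw a b hab h) hab
  · simp
  · exact iff_of_false (hw b a hab h.symm).not_gt hab.not_gt

theorem apply_inv_self' (w : W r) (a : Fin r) : w (w⁻¹ a) = a := w.apply_symm_apply a

theorem comp_inv_eq {β : Type*} {g : Fin r → β} {u : W r} (hu : g ∘ u = g) : g ∘ ⇑u⁻¹ = g := by
  funext a
  rw [Function.comp_apply, ← congrFun hu (u⁻¹ a), Function.comp_apply, apply_inv_self']

theorem mem_invSet {w : W r} {p : Fin r × Fin r} :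
    p ∈ invSet w ↔ p.1 < p.2 ∧ w⁻¹ p.2 < w⁻¹ p.1 := by
  simp [invSet]

theorem invSet_one : invSet (1 : W r) = ∅ := by
  ext p
  simp only [mem_invSet, inv_one, Equiv.Perm.one_apply, Finset.notMem_empty, iff_false, not_and]
  exact fun h => h.not_gt

theorem eq_of_mem_invSet {g : Fin r → α} (hg : Monotone g) {u : W r} (hu : g ∘ u = g)
    {p : Fin r × Fin r} (hp : p ∈ invSet u) : g p.1 = g p.2 := by
  rw [mem_invSet] at hp
  refine le_antisymm (hg hp.1.le) ?_
  rw [← congrFun (comp_inv_eq hu) p.1, ← congrFun (comp_inv_eq hu) p.2]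
  exact hg hp.2.le

theorem FibreIncr.lt_of_mem_invSet {g : Fin r → α} (hg : Monotone g) {w : W r}
    (hw : FibreIncr g w) {p : Fin r × Fin r} (hp : p ∈ invSet w) : g p.1 < g p.2 := by
  rw [mem_invSet] at hp
  exact (hg hp.1.le).lt_of_ne fun h => hp.2.not_gt (hw _ _ hp.1 h)

/-- On a pair inside one fibre `w⁻¹` keeps the order, so only `u` can invert it. On a pair from two
fibres `u⁻¹` keeps the order, so only `w` can. -/
theorem mem_invSet_mul {g : Fin r → α} (hg : Monotone g) {u w : W r} (hu : g ∘ u = g)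
    (hw : FibreIncr g w) (p : Fin r × Fin r) :
    p ∈ invSet (u * w) ↔ p ∈ invSet u ∨ (u⁻¹ p.1, u⁻¹ p.2) ∈ invSet w := by
  have hui := comp_inv_eq hu
  have h1 : g (u⁻¹ p.1) = g p.1 := congrFun hui _
  have h2 : g (u⁻¹ p.2) = g p.2 := congrFun hui _
  constructor
  · intro h
    have h' := mem_invSet.1 h
    rw [mul_inv_rev, Equiv.Perm.mul_apply, Equiv.Perm.mul_apply] at h'
    rcases (hg h'.1.le).eq_or_lt with he | hlt
    · left
      exact mem_invSet.2 ⟨h'.1, (hw.lt_iff (by rw [h1, h2, he])).1 h'.2⟩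
    · right
      rw [← h1, ← h2] at hlt
      exact mem_invSet.2 ⟨hg.reflect_lt hlt, h'.2⟩
  · rintro (h | h)
    · have he := eq_of_mem_invSet hg hu h
      rw [mem_invSet] at h ⊢
      exact ⟨h.1, by
        rw [mul_inv_rev, Equiv.Perm.mul_apply, Equiv.Perm.mul_apply]
        exact (hw.lt_iff (by rw [h1, h2, he])).2 h.2⟩
    · have hlt := hw.lt_of_mem_invSet hg h
      simp only [h1, h2] at hlt
      rw [mem_invSet] at h ⊢
      exact ⟨hg.reflect_lt hlt, h.2⟩

/-- A general factor `F` serves two purposes: a constant one yields additivity of length, the weight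
`chi` yields multiplicativity of `coef`. -/
theorem prod_invSet_mul {M : Type*} [CommMonoid M] {g : Fin r → α} (hg : Monotone g) {u w : W r}
    (hu : g ∘ u = g) (hw : FibreIncr g w) (F : Fin r × Fin r → M) :
    ∏ p ∈ invSet (u * w), F p =
      (∏ p ∈ invSet u, F p) * ∏ p ∈ invSet w, F (u p.1, u p.2) := by
  classical
  have hdisj : Disjoint (invSet u)
      ((invSet w).map (Equiv.prodCongr u u).toEmbedding) := by
    rw [Finset.disjoint_right]
    intro p hp hp'
    rw [Finset.mem_map] at hp
    obtain ⟨p, hp, rfl⟩ := hp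
    have h1 := hw.lt_of_mem_invSet hg hp
    have h2 := eq_of_mem_invSet hg hu hp'
    have e1 : g (u p.1) = g p.1 := congrFun hu _
    have e2 : g (u p.2) = g p.2 := congrFun hu _
    change g (u p.1) = g (u p.2) at h2
    rw [e1, e2] at h2
    exact h1.ne h2
  have hun : invSet (u * w) = (invSet u).disjUnion _ hdisj := by
    ext p
    rw [mem_invSet_mul hg hu hw, Finset.mem_disjUnion, Finset.mem_map]
    refine or_congr Iff.rfl ⟨fun h => ⟨_, h, ?_⟩, ?_⟩
    · exact Prod.ext (apply_inv_self' u _) (apply_inv_self' u _)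
    · rintro ⟨p, h, rfl⟩
      change (u⁻¹ (u p.1), u⁻¹ (u p.2)) ∈ _
      rwa [inv_apply_self', inv_apply_self']
  rw [hun, Finset.prod_disjUnion, Finset.prod_map]
  rfl

theorem len_mul {g : Fin r → α} (hg : Monotone g) {u w : W r} (hu : g ∘ u = g)
    (hw : FibreIncr g w) : len (u * w) = len u + len w := by
  have := prod_invSet_mul hg hu hw fun _ => Multiplicative.ofAdd 1
  simp only [Finset.prod_const, ← ofAdd_nsmul, ← ofAdd_add, Multiplicative.ofAdd.injective.eq_iff,
    smul_eq_mul, mul_one] at this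
  rw [len_eq, len_eq, len_eq, this]

theorem prod_invSet_inv {M : Type*} [CommMonoid M] (w : W r) (F : Fin r × Fin r → M) :
    ∏ p ∈ invSet w⁻¹, F p = ∏ p ∈ invSet w, F (w⁻¹ p.2, w⁻¹ p.1) := by
  refine Finset.prod_bij' (fun p _ => (w p.2, w p.1)) (fun p _ => (w⁻¹ p.2, w⁻¹ p.1)) ?_ ?_ ?_ ?_ ?_
  · intro p hp
    rw [mem_invSet] at hp ⊢
    rw [inv_inv] at hp
    simpa only [inv_apply_self'] using hp.symm
  · intro p hp
    rw [mem_invSet] at hp ⊢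
    rw [inv_inv]
    simpa only [apply_inv_self'] using hp.symm
  · intro p _
    simp only [inv_apply_self']
  · intro p _
    simp only [apply_inv_self']
  · intro p _
    simp only [inv_apply_self']

theorem len_inv (w : W r) : len w⁻¹ = len w := by
  have := prod_invSet_inv w fun _ => Multiplicative.ofAdd 1
  simp only [Finset.prod_const, ← ofAdd_nsmul, Multiplicative.ofAdd.injective.eq_iff,
    smul_eq_mul, mul_one] at this
  rw [len_eq, len_eq, this]

theorem comp_s_eq {β : Type*} {g : Fin r → β} {k : Fin (r - 1)} (h : g (lo k) = g (hi k)) :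
    g ∘ s k = g := by
  funext a
  change g (s k a) = g a
  unfold s
  rw [Equiv.swap_apply_def]
  split_ifs with h1 h2
  · rw [h1, h]
  · rw [h2, h]
  · rfl

/-- The shortest coset representatives for the stabiliser of a monotone map. -/
theorem mem_distinguished_iff {g : Fin r → α} (hg : Monotone g) {P : Subgroup (W r)}
    (hP : ∀ w, w ∈ P ↔ g ∘ w = g) (w : W r) : w ∈ distinguished P ↔ FibreIncr g w := by
  constructor
  · intro hw
    by_contra hcon
    unfold FibreIncr at hcon
    push Not at hcon
    obtain ⟨a, b, hab, he, hle⟩ := hcon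
    have hlt : w⁻¹ b < w⁻¹ a := hle.lt_of_ne fun h => hab.ne' (w⁻¹.injective h)
    -- Monotonicity of `g` puts `lo k` and `hi k` into the fibre of `a` and `b`, so `s k` lies in
    -- `P` and shortens `w` from the left.
    obtain ⟨k, h1, h2, h3⟩ := exists_adjacent_descent (⇑w⁻¹) hab hlt
    have hk : g (lo k) = g (hi k) := by
      refine le_antisymm (hg (lo_lt_hi k).le) ?_
      exact (hg h2).trans (he ▸ hg h1)
    have h4 := hw (s k) ((hP _).2 (comp_s_eq hk))
    rw [← len_inv, ← len_inv (s k * w), mul_inv_rev, s_inv, len_eq, len_eq] at h4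
    have := card_invSet_desc w⁻¹ k h3
    omega
  · intro hw u hu
    rw [len_mul hg ((hP u).1 hu) hw]
    exact Nat.le_add_left _ _

theorem fibreIncr_one {α : Type*} (g : Fin r → α) : FibreIncr g 1 := fun _ _ h _ => by simpa using h

/-- An inversion of `w` would have to lie inside a fibre and to join two different fibres. -/
theorem FibreIncr.eq_one {g : Fin r → α} {w : W r} (hg : Monotone g) (hw : FibreIncr g w)
    (h : g ∘ w = g) : w = 1 := by
  by_contra hne
  obtain ⟨k, hk⟩ := exists_desc w⁻¹ (by simpa using hne)
  have hp : (lo k, hi k) ∈ invSet w := mem_invSet.2 ⟨lo_lt_hi k, hk⟩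
  exact (hw.lt_of_mem_invSet hg hp).ne (eq_of_mem_invSet hg h hp)

/-- Right multiplication of a shortest coset representative by a basic transposition. -/
theorem FibreIncr.mul_s {g : Fin r → α} (hg : Monotone g) {w : W r} (hw : FibreIncr g w)
    (k : Fin (r - 1)) : FibreIncr g (w * s k) ∨
      ∃ j, g (lo j) = g (hi j) ∧ w * s k = s j * w ∧ w (lo k) = lo j ∧ w (hi k) = hi j := by
  by_cases he : g (w (lo k)) = g (w (hi k))
  · right
    have hlt : w (lo k) < w (hi k) := by
      rw [← hw.lt_iff he, inv_apply_self', inv_apply_self']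
      exact lo_lt_hi k
    -- A letter strictly between the two values would lie in the same fibre, so its preimage would
    -- lie strictly between the neighbours `lo k` and `hi k`.
    have hadj : (w (hi k)).1 = (w (lo k)).1 + 1 := by
      by_contra hne
      have hlt' := Fin.lt_def.1 hlt
      let c : Fin r := ⟨(w (lo k)).1 + 1, by omega⟩
      have h1 : w (lo k) < c := Fin.lt_def.2 (by simp [c])
      have h2 : c < w (hi k) := Fin.lt_def.2 (by simp only [c]; omega)
      have e1 : g (w (lo k)) = g c := le_antisymm (hg h1.le) (he ▸ hg h2.le)
      have h3 := (hw.lt_iff e1).2 h1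
      have h4 := (hw.lt_iff (e1.symm.trans he)).2 h2
      rw [inv_apply_self'] at h3 h4
      simp only [lo, hi, Fin.lt_def] at h3 h4
      omega
    refine ⟨⟨(w (lo k)).1, by omega⟩, ?_⟩
    have e1 : w (lo k) = lo ⟨(w (lo k)).1, by omega⟩ := rfl
    have e2 : w (hi k) = hi ⟨(w (lo k)).1, by omega⟩ := Fin.ext hadj
    refine ⟨by rw [← e1, ← e2, he], ?_, e1, e2⟩
    unfold s
    rw [Equiv.mul_swap_eq_swap_mul, ← e1, ← e2]
  · left
    intro a b hab h
    rw [mul_inv_rev, s_inv, Equiv.Perm.mul_apply, Equiv.Perm.mul_apply, s_lt_s]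
    · exact hw a b hab h
    · rintro ⟨h1, h2⟩
      rw [← h1, ← h2, apply_inv_self', apply_inv_self'] at he
      exact he h
    · rintro ⟨h1, h2⟩
      rw [← h1, ← h2, apply_inv_self', apply_inv_self'] at he
      exact he h.symm

end Fibres

/-! ### Multiplicativity of the coefficients of the action -/

section Coefficients

variable {R : Type*} [CommRing R] (q : Rˣ) {m n r : ℕ}

theorem coef_one (j : MultiIndex m n r) : coef q j 1 = 1 := by
  simp [coef, invSet_one]

theorem coef_inv {j : MultiIndex m n r} {w : W r} (h : j ∘ w = j) : coef q j w⁻¹ = coef q j w := by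
  have hi := comp_inv_eq h
  unfold coef
  rw [prod_invSet_inv]
  refine Finset.prod_congr rfl fun p _ => ?_
  rw [chi_comm]
  exact congrArg₂ (chi q) (congrFun hi p.1) (congrFun hi p.2)

theorem coef_mul {α : Type*} [LinearOrder α] {g : Fin r → α} (hg : Monotone g) {u w : W r}
    (hu : g ∘ u = g) (hw : FibreIncr g w) {j : MultiIndex m n r} (hj : j ∘ u = j) :
    coef q j (u * w) = coef q j u * coef q j w := by
  unfold coef
  rw [prod_invSet_mul hg hu hw]
  congr 1
  refine Finset.prod_congr rfl fun p _ => ?_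
  exact congrArg₂ (chi q) (congrFun hj p.1) (congrFun hj p.2)

end Coefficients

/-! ### Multi-indices, compositions and double coset representatives -/

section Weights

variable {m n r : ℕ}

theorem monotone_iOf (lam : Composition m n r) : Monotone (iOf lam) := by
  intro a b hab
  by_contra! hlt
  have h1 := ((iOf_eq_iff lam a _).1 rfl).1
  have h2 := ((iOf_eq_iff lam b _).1 rfl).2
  have h3 : ∑ j ∈ Finset.Iic (iOf lam b), lam.1 j ≤ ∑ j ∈ Finset.Iio (iOf lam a), lam.1 j :=
    Finset.sum_le_sum_of_subset fun x hx =>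
      Finset.mem_Iio.2 ((Finset.mem_Iic.1 hx).trans_lt hlt)
  have := Fin.le_def.1 hab
  omega

/-- The composition counting how often each index occurs in a multi-index. -/
def weight (i : MultiIndex m n r) : Composition m n r :=
  ⟨fun a => (Finset.univ.filter fun k => i k = a).card, by
    rw [← Finset.card_eq_sum_card_fiberwise (fun _ _ => Finset.mem_coe.2 (Finset.mem_univ _))]
    simp⟩

theorem weight_comp (i : MultiIndex m n r) (w : W r) : weight (i ∘ w) = weight i := by
  refine Subtype.ext (funext fun a => ?_)
  change (Finset.univ.filter fun k => i (w k) = a).card = (Finset.univ.filter fun k => i k = a).card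
  refine Finset.card_bij (fun k _ => w k) (fun k hk => ?_) (fun _ _ _ _ h => w.injective h)
    fun k hk => ⟨w⁻¹ k, ?_, apply_inv_self' w k⟩
  · simpa using hk
  · simpa [apply_inv_self'] using hk

theorem weight_iOf (lam : Composition m n r) : weight (iOf lam) = lam := by
  refine Subtype.ext (funext fun a => ?_)
  change (Finset.univ.filter fun k => iOf lam k = a).card = lam.1 a
  rw [← Fintype.card_subtype]
  let e : Fin r ≃ (Σ i, Fin (lam.1 i)) := (finCongr lam.2.symm).trans finSigmaFinEquiv.symm
  have e1 : {k // iOf lam k = a} ≃ {p : Σ i, Fin (lam.1 i) // p.1 = a} :=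
    e.subtypeEquiv fun k => Iff.rfl
  rw [Fintype.card_congr (e1.trans (Equiv.sigmaSubtype a)), Fintype.card_fin]

/-- In a monotone tuple, the number of entries below a value marks the place where that value
begins. Together with `weight_iOf` this identifies compositions with monotone multi-indices. -/
theorem iOf_weight {j : MultiIndex m n r} (hj : Monotone j) : iOf (weight j) = j := by
  funext k
  have h1 : ∀ s : Finset (Fin (m + n)), ∑ a ∈ s, (weight j).1 a =
      (Finset.univ.filter fun k => j k ∈ s).card := by
    intro s
    rw [Finset.card_eq_sum_card_fiberwise (f := j) (t := s) (fun x hx => by simpa using hx)]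
    refine Finset.sum_congr rfl fun a ha => ?_
    change (Finset.univ.filter fun k => j k = a).card = _
    congr 1
    ext x
    simp only [Finset.mem_filter, Finset.mem_univ, true_and]
    exact ⟨fun h => ⟨h ▸ ha, h⟩, fun h => h.2⟩
  rw [iOf_eq_iff, h1, h1]
  simp only [Finset.mem_Iio, Finset.mem_Iic]
  exact ⟨not_lt.1 fun h => ((Tuple.lt_card_lt_iff_apply_lt_of_monotone hj).1 h).false,
    (Tuple.lt_card_le_iff_apply_le_of_monotone hj).2 le_rfl⟩

/-- The permutation `d ∈ 𝒟_λ` with `i = i_λ d`. -/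
def coset (i : MultiIndex m n r) : W r := (Tuple.sort i)⁻¹

theorem iOf_weight_comp_coset (i : MultiIndex m n r) : iOf (weight i) ∘ coset i = i := by
  rw [← weight_comp i (Tuple.sort i), iOf_weight (Tuple.monotone_sort i)]
  funext k
  exact congrArg i (apply_inv_self' (Tuple.sort i) k)

/-- `Tuple.sort` is stable: it keeps the places of equal entries in order. -/
theorem fibreIncr_coset (i : MultiIndex m n r) : FibreIncr (iOf (weight i)) (coset i) := by
  intro a b hab h
  have h1 := (Tuple.eq_sort_iff.1 (rfl : Tuple.sort i = Tuple.sort i)).2 a b hab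
  rw [← weight_comp i (Tuple.sort i), iOf_weight (Tuple.monotone_sort i)] at h
  rw [coset, inv_inv]
  exact h1 h

theorem coset_eq {lam : Composition m n r} {d : W r} (hd : FibreIncr (iOf lam) d) :
    coset (iOf lam ∘ d) = d := by
  have hc : (iOf lam ∘ d) ∘ ⇑d⁻¹ = iOf lam := by
    funext k
    exact congrArg (iOf lam) (apply_inv_self' d k)
  have : d⁻¹ = Tuple.sort (iOf lam ∘ d) := by
    rw [Tuple.eq_sort_iff, hc]
    refine ⟨monotone_iOf lam, fun a b hab h => hd a b hab ?_⟩
    rw [← hc]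
    exact h
  rw [coset, ← this, inv_inv]

theorem mem_young {lam : Composition m n r} {w : W r} : w ∈ young lam ↔ iOf lam ∘ w = iOf lam :=
  funext_iff.symm

theorem mem_distinguished_young {lam : Composition m n r} {w : W r} :
    w ∈ distinguished (young lam) ↔ FibreIncr (iOf lam) w :=
  mem_distinguished_iff (monotone_iOf lam) (fun _ => mem_young) w

theorem mem_conjBy {P : Subgroup (W r)} {d w : W r} : w ∈ conjBy P d ↔ d * w * d⁻¹ ∈ P := by
  unfold conjBy
  rw [Subgroup.mem_map]
  constructor
  · rintro ⟨u, hu, rfl⟩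
    simpa [mul_assoc] using hu
  · exact fun h => ⟨_, h, by simp [mul_assoc]⟩

/-- The pairs of entries of `i_μ` and `i_λ d`, ordered lexicographically. -/
def pairIndex (lam mu : Composition m n r) (d : W r) : Fin r → Fin (m + n) ×ₗ Fin (m + n) :=
  fun k => toLex (iOf mu k, iOf lam (d k))

theorem pairIndex_eq_iff {lam mu : Composition m n r} {d : W r} {a b : Fin r} :
    pairIndex lam mu d a = pairIndex lam mu d b ↔
      iOf mu a = iOf mu b ∧ iOf lam (d a) = iOf lam (d b) := by
  simp [pairIndex]

/-- Conjugation by `d` turns the stabiliser of `i_λ` into that of `i_λ d`, so the intersection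
stabilises the sequence of pairs. -/
theorem mem_youngInter {lam mu : Composition m n r} {d w : W r} :
    w ∈ youngInter lam mu d ↔ pairIndex lam mu d ∘ w = pairIndex lam mu d := by
  rw [youngInter, Subgroup.mem_inf, mem_conjBy, funext_iff]
  simp only [Function.comp_apply, pairIndex_eq_iff]
  constructor
  · rintro ⟨h1, h2⟩ k
    refine ⟨h2 k, ?_⟩
    simpa [Equiv.Perm.mul_apply, inv_apply_self'] using h1 (d k)
  · refine fun h => ⟨fun k => ?_, fun k => (h k).1⟩
    simpa [Equiv.Perm.mul_apply, apply_inv_self'] using (h (d⁻¹ k)).2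

theorem mem_doubleReps {lam mu : Composition m n r} {d : W r} :
    d ∈ doubleReps lam mu ↔
      FibreIncr (iOf lam) d ∧ ∀ a b, a < b → iOf mu a = iOf mu b → d a < d b := by
  unfold doubleReps
  rw [Set.mem_ofPred_eq, mem_distinguished_young, mem_distinguished_young]
  refine and_congr_right fun _ => ?_
  simp only [FibreIncr, inv_inv]

/-- Monotonicity, available because `d` increases on the blocks of `μ`, is what allows
`mem_distinguished_iff` to be applied to `W_ν`. -/
theorem monotone_pairIndex {lam mu : Composition m n r} {d : W r} (hd : d ∈ doubleReps lam mu) :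
    Monotone (pairIndex lam mu d) := by
  intro a b hab
  rcases hab.eq_or_lt with rfl | hab
  · exact le_rfl
  refine Prod.Lex.toLex_le_toLex.2 ?_
  rcases (monotone_iOf mu hab.le).lt_or_eq with h | h
  · exact Or.inl h
  · exact Or.inr ⟨h, monotone_iOf lam ((mem_doubleReps.1 hd).2 a b hab h).le⟩

/-- In a block of `μ`, different entries of `i` are already in order, and equal ones are kept in
order by the stable sort. -/
theorem coset_mem_doubleReps {mu : Composition m n r} {i : MultiIndex m n r}
    (hi : ∀ a b, a < b → iOf mu a = iOf mu b → i a ≤ i b) :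
    coset i ∈ doubleReps (weight i) mu := by
  refine mem_doubleReps.2 ⟨fibreIncr_coset i, fun a b hab h => ?_⟩
  have hc := iOf_weight_comp_coset i
  have ha : iOf (weight i) (coset i a) = i a := congrFun hc a
  have hb : iOf (weight i) (coset i b) = i b := congrFun hc b
  rcases (hi a b hab h).lt_or_eq with hlt | he
  · rw [← ha, ← hb] at hlt
    exact (monotone_iOf _).reflect_lt hlt
  · rw [← ha, ← hb] at he
    rw [← (fibreIncr_coset i).lt_iff he, inv_apply_self', inv_apply_self']
    exact hab

theorem swap_mem_young {lam : Composition m n r} {a b : Fin r} (h : iOf lam a = iOf lam b) :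
    Equiv.swap a b ∈ young lam := by
  intro k
  rw [Equiv.swap_apply_def]
  split_ifs with h1 h2
  · rw [h1, h]
  · rw [h2, h]
  · rfl

theorem swap_mem_youngEven {lam : Composition m n r} {a b : Fin r} (h : iOf lam a = iOf lam b)
    (ha : ¬ IsOdd (iOf lam a)) : Equiv.swap a b ∈ youngEven lam :=
  ⟨swap_mem_young h, fun k hk => Equiv.swap_apply_of_ne_of_ne (by rintro rfl; exact ha hk)
    (by rintro rfl; exact ha (h ▸ hk))⟩

theorem swap_mem_youngOdd {lam : Composition m n r} {a b : Fin r} (h : iOf lam a = iOf lam b)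
    (ha : IsOdd (iOf lam a)) : Equiv.swap a b ∈ youngOdd lam :=
  ⟨swap_mem_young h, fun k hk => Equiv.swap_apply_of_ne_of_ne (by rintro rfl; exact hk ha)
    (by rintro rfl; exact hk (h ▸ ha))⟩

theorem mul_swap_mul_inv (d : W r) (a b : Fin r) :
    d * Equiv.swap a b * d⁻¹ = Equiv.swap (d a) (d b) := by
  rw [Equiv.mul_swap_eq_swap_mul, mul_inv_cancel_right]

/-- The even-odd trivial intersection property in terms of the entries of `i_μ` and `i_λ d`. -/
theorem mem_doubleRepsCirc {lam mu : Composition m n r} {d : W r} :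
    d ∈ doubleRepsCirc lam mu ↔ d ∈ doubleReps lam mu ∧ ∀ a b, a ≠ b → iOf mu a = iOf mu b →
      iOf lam (d a) = iOf lam (d b) → (IsOdd (iOf mu a) ↔ IsOdd (iOf lam (d a))) := by
  unfold doubleRepsCirc
  rw [Set.mem_ofPred_eq]
  refine and_congr_right fun _ => ?_
  simp only [Subgroup.eq_bot_iff_forall, Subgroup.mem_inf, mem_conjBy]
  constructor
  · rintro ⟨h1, h2⟩ a b hab hmu hlam
    -- Transpositions suffice as test elements: if the parities differed, this one would lie in one
    -- of the two intersections.
    have hne : Equiv.swap a b ≠ 1 := fun h => hab (Equiv.swap_eq_one_iff.1 h)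
    constructor
    · intro ho
      by_contra he
      refine hne (h1 _ ⟨?_, swap_mem_youngOdd hmu ho⟩)
      rw [mul_swap_mul_inv]
      exact swap_mem_youngEven hlam he
    · intro ho
      by_contra he
      refine hne (h2 _ ⟨?_, swap_mem_youngEven hmu he⟩)
      rw [mul_swap_mul_inv]
      exact swap_mem_youngOdd hlam ho
  · intro h
    -- A nontrivial element of an intersection moves some `a`; the parity condition is then applied
    -- to the pair `a`, `w a`.
    have key : ∀ w : W r, (∀ a, w a ≠ a → iOf lam (d (w a)) = iOf lam (d a) →
        iOf mu (w a) = iOf mu a → False) → d * w * d⁻¹ ∈ young lam → w ∈ young mu → w = 1 := by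
      intro w hw h1 h2
      ext1 a
      by_contra hne
      refine hw a hne ?_ (h2 a)
      simpa [Equiv.Perm.mul_apply, inv_apply_self'] using h1 (d a)
    have hmove : ∀ (w : W r) a, w a ≠ a → (d * w * d⁻¹) (d a) ≠ d a := by
      intro w a hne he
      rw [Equiv.Perm.mul_apply, Equiv.Perm.mul_apply, inv_apply_self'] at he
      exact hne (d.injective he)
    constructor
    · rintro w ⟨h1, h2⟩
      refine key w (fun a hne hl hm => ?_) h1.1 h2.1
      have e1 : IsOdd (iOf mu a) := by
        by_contra hc
        exact hne (h2.2 a hc)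
      have e2 : ¬ IsOdd (iOf lam (d a)) := fun hc => hmove w a hne (h1.2 _ hc)
      exact e2 ((h a (w a) hne.symm hm.symm hl.symm).1 e1)
    · rintro w ⟨h1, h2⟩
      refine key w (fun a hne hl hm => ?_) h1.1 h2.1
      have e1 : ¬ IsOdd (iOf mu a) := fun hc => hne (h2.2 a hc)
      have e2 : IsOdd (iOf lam (d a)) := by
        by_contra hc
        exact hmove w a hne (h1.2 _ hc)
      exact e1 ((h a (w a) hne.symm hm.symm hl.symm).2 e2)

/-- The index `i_λ d` determines `λ` as its weight and `d` through its stable sort. -/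
theorem Triple.eq_of_index_eq {t t' : Triple m n r} (hmu : t.mu = t'.mu)
    (h : iOf t.lam ∘ t.d = iOf t'.lam ∘ t'.d) : t = t' := by
  have h1 := (mem_doubleReps.1 t.mem.1).1
  have h2 := (mem_doubleReps.1 t'.mem.1).1
  have hd : t.d = t'.d := by rw [← coset_eq h1, h, coset_eq h2]
  have hl : t.lam = t'.lam := by
    rw [← weight_iOf t.lam, ← weight_comp _ t.d, h, weight_comp, weight_iOf]
  obtain ⟨lam, mu, d, _⟩ := t
  obtain ⟨lam', mu', d', _⟩ := t'
  simp only at hmu hd hl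
  subst hmu hd hl
  rfl

instance : Finite (Composition m n r) := by
  refine Finite.of_injective (fun lam : Composition m n r => iOf lam) fun a b h => ?_
  rw [← weight_iOf a, ← weight_iOf b]
  exact congrArg weight h

instance : Finite (Triple m n r) := by
  refine Finite.of_injective
    (fun t : Triple m n r => (t.mu, iOf t.lam ∘ t.d)) fun a b h => ?_
  exact Triple.eq_of_index_eq (congrArg Prod.fst h) (congrArg Prod.snd h)

end Weights

/-! ### Even and odd parts of a Young subgroup -/

section EvenOdd

variable {m n r : ℕ}

/-- A monotone map whose stabiliser is the even part of the Young subgroup. -/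
def evenIndex (lam : Composition m n r) (k : Fin r) : ℕ :=
  if IsOdd (iOf lam k) then m + k else iOf lam k

theorem monotone_evenIndex (lam : Composition m n r) : Monotone (evenIndex lam) := by
  intro a b hab
  have h1 := Fin.le_def.1 (monotone_iOf lam hab)
  have h2 := Fin.le_def.1 hab
  by_cases ha : IsOdd (iOf lam a) <;> by_cases hb : IsOdd (iOf lam b) <;>
    simp only [evenIndex, ha, hb, if_true, if_false] <;> unfold IsOdd at ha hb <;> omega

/-- Odd letters receive the distinct values `m + k`, all at least `m`, while even blocks have
indices below `m`; so only even blocks can be fibres with several elements. -/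
theorem evenIndex_eq_iff {lam : Composition m n r} {a b : Fin r} :
    evenIndex lam a = evenIndex lam b ↔
      a = b ∨ (¬ IsOdd (iOf lam a) ∧ iOf lam a = iOf lam b) := by
  rcases eq_or_ne a b with rfl | hab
  · simp
  rw [Ne, Fin.ext_iff] at hab
  rw [Fin.ext_iff, Fin.ext_iff]
  by_cases ha : IsOdd (iOf lam a) <;> by_cases hb : IsOdd (iOf lam b) <;>
    simp only [evenIndex, ha, hb, if_true, if_false, not_true, not_false_iff, false_and, true_and,
      or_false] <;>
    unfold IsOdd at ha hb <;> omega

theorem evenIndex_comp {lam : Composition m n r} {w : W r} (hw : w ∈ youngEven lam) :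
    evenIndex lam ∘ w = evenIndex lam := by
  funext k
  rw [Function.comp_apply, evenIndex_eq_iff, hw.1 k]
  by_cases hk : IsOdd (iOf lam k)
  · exact Or.inl (hw.2 k hk)
  · exact Or.inr ⟨hk, rfl⟩

/-- The odd part fixes every even letter. By `len_mul`, lengths then add in products of an even and
an odd element. -/
theorem fibreIncr_evenIndex {lam : Composition m n r} {w : W r} (hw : w ∈ youngOdd lam) :
    FibreIncr (evenIndex lam) w := by
  intro a b hab h
  rcases evenIndex_eq_iff.1 h with rfl | ⟨h1, h2⟩
  · exact absurd hab (lt_irrefl _)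
  · rwa [((youngOdd lam).inv_mem hw).2 a h1, ((youngOdd lam).inv_mem hw).2 b (h2 ▸ h1)]

/-- The odd factor is the restriction of `w` to the letters of odd blocks, a set preserved by `w`.
-/
theorem exists_even_mul_odd {lam : Composition m n r} {w : W r} (hw : w ∈ young lam) :
    ∃ u ∈ youngEven lam, ∃ u' ∈ youngOdd lam, u * u' = w := by
  have hodd : ∀ k, IsOdd (iOf lam (w k)) ↔ IsOdd (iOf lam k) := fun k => by rw [hw k]
  let u' : W r := Equiv.Perm.ofSubtype (w.subtypePerm (p := fun k => IsOdd (iOf lam k)) hodd)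
  have h1 : ∀ k, IsOdd (iOf lam k) → u' k = w k := fun k hk =>
    Equiv.Perm.ofSubtype_apply_of_mem (p := fun k => IsOdd (iOf lam k)) _ hk
  have h2 : ∀ k, ¬ IsOdd (iOf lam k) → u' k = k := fun k hk =>
    Equiv.Perm.ofSubtype_apply_of_not_mem _ hk
  have hu' : u' ∈ youngOdd lam := by
    refine ⟨fun k => ?_, h2⟩
    by_cases hk : IsOdd (iOf lam k)
    · rw [h1 k hk, hw k]
    · rw [h2 k hk]
  refine ⟨w * u'⁻¹, ⟨(young lam).mul_mem hw ((young lam).inv_mem hu'.1), fun k hk => ?_⟩,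
    u', hu', by simp⟩
  have h3 : IsOdd (iOf lam (u'⁻¹ k)) := by rwa [(young lam).inv_mem hu'.1 k]
  rw [Equiv.Perm.mul_apply, ← h1 _ h3, apply_inv_self']

theorem even_mul_odd_injective {lam : Composition m n r} {u w u' w' : W r}
    (hu : u ∈ youngEven lam) (hu' : u' ∈ youngEven lam) (hw : w ∈ youngOdd lam)
    (hw' : w' ∈ youngOdd lam) (h : u * w = u' * w') : u = u' ∧ w = w' := by
  have h1 : u'⁻¹ * u = w' * w⁻¹ := by
    rw [inv_mul_eq_iff_eq_mul, ← mul_assoc, ← h, mul_inv_cancel_right]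
  have he := (youngEven lam).mul_mem ((youngEven lam).inv_mem hu') hu
  have ho := (youngOdd lam).mul_mem hw' ((youngOdd lam).inv_mem hw)
  have h2 : u'⁻¹ * u = 1 := by
    ext1 k
    by_cases hk : IsOdd (iOf lam k)
    · exact he.2 k hk
    · rw [h1]; exact ho.2 k hk
  exact ⟨(inv_mul_eq_one.1 h2).symm, (mul_inv_eq_one.1 (h1 ▸ h2)).symm⟩

open scoped Classical in
theorem sum_even_mul_odd {M : Type*} [AddCommMonoid M] (lam : Composition m n r) (p : W r → Prop)
    (F : W r → M) : ∑ w : W r × W r with w.1 ∈ youngEven lam ∧ w.2 ∈ youngOdd lam ∧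
      p (w.1 * w.2), F (w.1 * w.2) = ∑ w : W r with w ∈ young lam ∧ p w, F w := by
  refine Finset.sum_bij (fun w _ => w.1 * w.2) ?_ ?_ ?_ fun _ _ => rfl
  · intro w hw
    simp only [Finset.mem_filter, Finset.mem_univ, true_and] at hw ⊢
    exact ⟨(young lam).mul_mem hw.1.1 hw.2.1.1, hw.2.2⟩
  · intro w hw w' hw' h
    simp only [Finset.mem_filter, Finset.mem_univ, true_and] at hw hw'
    obtain ⟨h1, h2⟩ := even_mul_odd_injective hw.1 hw'.1 hw.2.1 hw'.2.1 h
    exact Prod.ext h1 h2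
  · intro w hw
    simp only [Finset.mem_filter, Finset.mem_univ, true_and] at hw
    obtain ⟨u, hu, u', hu', rfl⟩ := exists_even_mul_odd hw.1
    exact ⟨(u, u'), by simpa using ⟨hu, hu', hw.2⟩, rfl⟩

end EvenOdd

open MulOpposite

/-! ### Products in the Hecke algebra and relative norms -/

section HeckeProducts

variable {R : Type*} [CommRing R] (q : Rˣ) {r : ℕ}

theorem not_desc_of_len_eq {w : W r} {k : Fin (r - 1)} (h : len (w * s k) = len w + 1) :
    ¬ desc w k := by
  rw [not_desc, ← len_lt_iff]
  omega

theorem len_mul_s {w : W r} {k : Fin (r - 1)} (h : ¬ desc w k) : len (w * s k) = len w + 1 := by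
  rw [len_eq, len_eq, card_invSet_asc w k ((not_desc w k).1 h)]

/-- Induction on permutations along reduced expressions. -/
theorem desc_induction {p : W r → Prop} (one : p 1)
    (mul_s : ∀ w k, ¬ desc w k → p w → p (w * s k)) (w : W r) : p w := by
  induction hn : len w generalizing w with
  | zero =>
    rcases eq_or_ne w 1 with rfl | hw
    · exact one
    · obtain ⟨k, hk⟩ := exists_desc w hw
      have := card_invSet_desc w k hk
      rw [len_eq] at hn
      omega
  | succ n ih =>
    rcases eq_or_ne w 1 with rfl | hw
    · exact one
    · obtain ⟨k, hk⟩ := exists_desc w hw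
      have := card_invSet_desc w k hk
      rw [← len_eq, ← len_eq] at this
      have h := mul_s (w * s k) k (by rw [desc_mul_s]; exact not_not.2 hk)
        (ih _ (by omega))
      rwa [mul_s_mul_s] at h

theorem len_mul_le (u w : W r) : len (u * w) ≤ len u + len w := by
  rw [← reducedWord_length u, ← reducedWord_length w, ← List.length_append, len_eq]
  have h : wordProd (reducedWord u ++ reducedWord w) = u * w := by
    rw [wordProd, List.map_append, List.prod_append]
    exact congrArg₂ _ (reducedWord_prod u) (reducedWord_prod w)
  rw [← h]
  exact card_invSet_le _

theorem T_mul_T_s_of_not_desc {w : W r} {k : Fin (r - 1)} (h : ¬ desc w k) :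
    T q w * T q (s k) = T q (w * s k) := by
  rw [T_mul_T_s, if_pos ((len_lt_iff _ _).2 ((not_desc _ _).1 h))]

theorem T_s_mul_T_s (k : Fin (r - 1)) :
    T q (s k) * T q (s k) = 1 + qdiff q • T q (s k) := by
  rw [T_mul_T_s, if_neg, s_mul_s, one_def, add_comm]
  rw [len_lt_iff, s_lo, s_hi]
  exact (lo_lt_hi k).not_gt

/-- The basis elements multiply as the permutations when lengths add. -/
theorem T_mul_T (u w : W r) (h : len (u * w) = len u + len w) :
    T q u * T q w = T q (u * w) := by
  induction w using desc_induction with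
  | one => rw [← one_def, mul_one, mul_one]
  | mul_s w k hk ih =>
    rw [len_mul_s hk, ← mul_assoc] at h
    -- The two upper bounds add up to the assumed length, so both are attained: lengths add for `u`
    -- and `w`, and `s k` is an ascent of `u * w`.
    have h1 := len_mul_le u w
    have h2 : len (u * w * s k) ≤ len (u * w) + 1 := by
      rcases lt_hi_lo_or (u * w) k with h | h
      · rw [len_mul_s ((not_desc _ _).2 h)]
      · have := card_invSet_desc _ k h
        rw [← len_eq, ← len_eq] at this
        omega
    rw [← T_mul_T_s_of_not_desc q hk, ← mul_assoc, ih (by omega),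
      T_mul_T_s_of_not_desc q (not_desc_of_len_eq (by omega)), mul_assoc]

theorem T_s_mul_T_inv {w : W r} {k : Fin (r - 1)} (h : ¬ desc w k) :
    T q (s k) * T q w⁻¹ = T q (w * s k)⁻¹ := by
  have h1 : (w * s k)⁻¹ = s k * w⁻¹ := by rw [mul_inv_rev, s_inv]
  have h2 : len (s k) = 1 := by
    have := len_mul_s (w := (1 : W r)) (k := k) (by rw [not_desc]; exact lo_lt_hi k)
    rwa [one_mul, len_eq 1, invSet_one] at this
  rw [h1, T_mul_T]
  rw [← h1, len_inv, len_inv, len_mul_s h, h2, add_comm]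

section Modules

variable {M M' : Type*} [AddCommGroup M] [Module R M] [Module (Hecke q r)ᵐᵒᵖ M]
  [IsScalarTower R (Hecke q r)ᵐᵒᵖ M] [AddCommGroup M'] [Module R M'] [Module (Hecke q r)ᵐᵒᵖ M']
  [IsScalarTower R (Hecke q r)ᵐᵒᵖ M']

variable {q}

theorem op_mul_smul {M : Type*} [AddCommGroup M] [Module (Hecke q r)ᵐᵒᵖ M] (h h' : Hecke q r)
    (x : M) : op (h * h') • x = op h' • op h • x := by
  rw [op_mul, mul_smul]

theorem op_eq_sum (h : Hecke q r) : op h = ∑ w, h w • op (T q w) := by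
  conv_lhs => rw [← sum_T q h]
  exact map_sum (opAddEquiv (α := Hecke q r)) _ _

/-- A linear map commuting with the `𝒯_s` commutes with the Hecke algebra. -/
theorem map_op_T_smul (F : M →ₗ[R] M')
    (hF : ∀ (k : Fin (r - 1)) x, F (op (T q (s k)) • x) = op (T q (s k)) • F x)
    (h : Hecke q r) (x : M) :
    F (op h • x) = op h • F x := by
  have key : ∀ w : W r, ∀ x, F (op (T q w) • x) = op (T q w) • F x := by
    intro w
    induction w using desc_induction with
    | one => simp [← one_def]
    | mul_s w k hk ih =>
      intro x
      rw [← T_mul_T_s_of_not_desc q hk, op_mul_smul, op_mul_smul, hF, ih]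
  rw [op_eq_sum, Finset.sum_smul, Finset.sum_smul, map_sum]
  refine Finset.sum_congr rfl fun w _ => ?_
  rw [smul_assoc, smul_assoc, map_smul, key]

theorem relNorm_top_apply (Q : Subgroup (W r)) (b : Module.End R M) (x : M) [DecidablePred
    (· ∈ distinguished Q)] : relNorm q ⊤ Q b x =
      ∑ w : W r with w ∈ distinguished Q, op (T q w) • b (op (T q w⁻¹) • x) := by
  unfold relNorm
  simp only [LinearMap.sum_apply, LinearMap.comp_apply, Algebra.lsmul_coe, Subgroup.mem_top,
    and_true]

/-- The relative norm of an endomorphism commuting with a parabolic subalgebra commutes with the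
Hecke algebra. -/
theorem relNorm_op_T_s_smul {α : Type*} [LinearOrder α] {g : Fin r → α} (hg : Monotone g)
    {Q : Subgroup (W r)} (hQ : ∀ w, w ∈ Q ↔ g ∘ w = g) (b : Module.End R M)
    (hb : ∀ j, g (lo j) = g (hi j) → ∀ x, b (op (T q (s j)) • x) = op (T q (s j)) • b x)
    (k : Fin (r - 1)) (x : M) :
    relNorm q ⊤ Q b (op (T q (s k)) • x) = op (T q (s k)) • relNorm q ⊤ Q b x := by
  classical
  have hD := mem_distinguished_iff hg hQ
  rw [relNorm_top_apply, relNorm_top_apply, Finset.smul_sum, ← sub_eq_zero,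
    ← Finset.sum_sub_distrib]
  set F : W r → M := fun w => op (T q w) • b (op (T q w⁻¹) • op (T q (s k)) • x) -
    op (T q (s k)) • op (T q w) • b (op (T q w⁻¹) • x) with hF
  have hsq : ∀ y : M, op (T q (s k)) • op (T q (s k)) • y =
      y + qdiff q • op (T q (s k)) • y := by
    intro y
    rw [← op_mul_smul, T_s_mul_T_s, op_add, op_one, add_smul, one_smul, op_smul, smul_assoc]
  -- In the term of `w * s k`, `𝒯_{s_k}` splits off both outer factors. The quadratic relation
  -- creates two multiples of `q - q⁻¹`, which cancel, and leaves the negative of the term of `w`.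
  have hasc : ∀ w, ¬ desc w k → F w + F (w * s k) = 0 := by
    intro w hw
    simp only [hF, ← T_mul_T_s_of_not_desc q hw, ← T_s_mul_T_inv q hw, op_mul_smul, hsq, smul_add,
      map_add, map_smul, smul_comm _ (qdiff q)]
    abel
  have hpair : ∀ w, F w + F (w * s k) = 0 := by
    intro w
    by_cases hw : desc w k
    · have := hasc (w * s k) (by rw [desc_mul_s]; exact not_not.2 hw)
      rwa [mul_s_mul_s, add_comm] at this
    · exact hasc w hw
  -- Here `w * s k = s j * w` with `s j` in the parabolic subgroup: `𝒯_{s_k}` passes the outer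
  -- factors as `𝒯_{s_j}`, which commutes with `b`.
  have hfix : ∀ w, FibreIncr g w → ¬ FibreIncr g (w * s k) → F w = 0 := by
    intro w hw hws
    obtain ⟨j, hj, he, h1, h2⟩ := (hw.mul_s hg k).resolve_left hws
    have hd : ¬ desc w k := by
      rw [not_desc, h1, h2]
      exact lo_lt_hi j
    have h3 : T q w * T q (s k) = T q (s j) * T q w := by
      rw [T_mul_T_s_of_not_desc q hd, he, T_mul_T]
      exact len_mul hg (comp_s_eq hj) hw
    have h4 : T q (s k) * T q w⁻¹ = T q w⁻¹ * T q (s j) := by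
      have h5 : (w * s k)⁻¹ = w⁻¹ * s j := by rw [he, mul_inv_rev, s_inv]
      rw [T_s_mul_T_inv q hd, h5, T_mul_T_s_of_not_desc]
      rw [not_desc, ← h1, ← h2, inv_apply_self', inv_apply_self']
      exact lo_lt_hi k
    simp only [hF]
    rw [← op_mul_smul (T q (s k)), h4, op_mul_smul, hb j hj, ← op_mul_smul (T q (s j)), ← h3,
      op_mul_smul, sub_self]
  -- Representatives `w` and `w * s k` cancel in pairs; a fixed point of the involution has a
  -- vanishing term.
  refine Finset.sum_involution
    (fun w _ => if FibreIncr g (w * s k) then w * s k else w) ?_ ?_ ?_ ?_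
  · intro w hw
    rw [Finset.mem_filter, hD] at hw
    change F w + F _ = 0
    split_ifs with h
    · exact hpair w
    · rw [hfix w hw.2 h, add_zero]
  · intro w hw hne
    rw [Finset.mem_filter, hD] at hw
    rw [if_pos (by_contra fun h => hne (hfix w hw.2 h))]
    intro h
    have h1 : s k = 1 := mul_eq_left.1 h
    have h2 := s_lo k
    rw [h1] at h2
    exact (lo_lt_hi k).ne h2
  · intro w hw
    split_ifs with h
    · exact Finset.mem_filter.2 ⟨Finset.mem_univ _, (hD _).2 h⟩
    · exact hw
  · intro w hw
    rw [Finset.mem_filter, hD] at hw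
    by_cases h : FibreIncr g (w * s k)
    · simp only [if_pos h, mul_s_mul_s, if_pos hw.2]
    · simp only [if_neg h]

end Modules

end HeckeProducts

/-! ### The norms as endomorphisms, and their coordinates -/

section TensorAction

variable {R : Type*} [CommRing R] {q : Rˣ} {m n r : ℕ}

theorem op_T_s_smul_of_le {i : MultiIndex m n r} {k : Fin (r - 1)} (h : i (lo k) ≤ i (hi k)) :
    op (T q (s k)) • (v i : TensorSpace R m n r) =
      chi q (i (lo k)) (i (hi k)) • v (i ∘ s k) := by
  rw [v_smul_T_s]
  rcases h.lt_or_eq with h | h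
  · rw [if_pos h, chi, if_neg h.ne]
  · rw [if_neg h.not_lt, if_pos h, chi, if_pos h, comp_s_eq h]
    split_ifs <;> rfl

/-- If `w` inverts no strict descent of `i`, then `𝒯_w` sends `v_i` to a multiple of `v_{iw}`. -/
theorem op_T_smul_v (i : MultiIndex m n r) (w : W r) (h : ∀ p ∈ invSet w, i p.1 ≤ i p.2) :
    op (T q w) • (v i : TensorSpace R m n r) = coef q i w • v (i ∘ w) := by
  induction w using desc_induction with
  | one => rw [coef_one, ← one_def, op_one, one_smul, one_smul]; rfl
  | mul_s w k hk ih =>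
    obtain ⟨-, h2⟩ := invSet_mul_s w k ((not_desc _ _).1 hk)
    rw [h2] at h
    rw [← T_mul_T_s_of_not_desc q hk, op_mul_smul,
      ih fun p hp => h p (Finset.mem_insert_of_mem hp), smul_comm,
      op_T_s_smul_of_le (h _ (Finset.mem_insert_self _ _)), coef_asc q i w k hk, smul_smul, mul_comm]
    rfl

theorem op_T_smul_v_of_monotone {i : MultiIndex m n r} (hi : Monotone i) (w : W r) :
    op (T q w) • (v i : TensorSpace R m n r) = coef q i w • v (i ∘ w) :=
  op_T_smul_v i w fun _ hp => hi (mem_invSet.1 hp).1.le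

theorem repr_v (i j : MultiIndex m n r) :
    tensorBasis.repr (v i : TensorSpace R m n r) j = if i = j then 1 else 0 := by
  rw [← tensorBasis_apply, Module.Basis.repr_self, Finsupp.single_apply]

theorem comp_s_comp_s {β : Type*} (i : Fin r → β) (k : Fin (r - 1)) : (i ∘ s k) ∘ s k = i := by
  funext a
  change i (s k (s k a)) = i a
  rw [← Equiv.Perm.mul_apply, s_mul_s, Equiv.Perm.one_apply]

theorem comp_s_eq_iff {β : Type*} {i j : Fin r → β} {k : Fin (r - 1)} :
    i ∘ s k = j ↔ i = j ∘ s k :=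
  ⟨fun h => by rw [← h, comp_s_comp_s], fun h => by rw [h, comp_s_comp_s]⟩

theorem comp_s_lo {β : Type*} (i : Fin r → β) (k : Fin (r - 1)) : (i ∘ s k) (lo k) = i (hi k) :=
  congrArg i (s_lo k)

theorem comp_s_hi {β : Type*} (i : Fin r → β) (k : Fin (r - 1)) : (i ∘ s k) (hi k) = i (lo k) :=
  congrArg i (s_hi k)

theorem sgn_comm (a b : Fin (m + n)) : sgn R a b = sgn R b a := by
  unfold sgn
  simp only [and_comm]

/-- The coefficient of `v_i` in `x 𝒯_s` if `i` has no strict descent at `s`. -/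
theorem repr_op_T_s_smul {i : MultiIndex m n r} {k : Fin (r - 1)} (h : i (lo k) ≤ i (hi k))
    (x : TensorSpace R m n r) : tensorBasis.repr (op (T q (s k)) • x) i =
      chi q (i (lo k)) (i (hi k)) * tensorBasis.repr x (i ∘ s k) := by
  have key : (tensorBasis (R := R)).coord i ∘ₗ
      Algebra.lsmul R R (TensorSpace R m n r) (op (T q (s k))) =
        chi q (i (lo k)) (i (hi k)) • (tensorBasis (R := R)).coord (i ∘ s k) := by
    refine tensorBasis.ext fun j => ?_
    rw [tensorBasis_apply]
    simp only [LinearMap.comp_apply, Algebra.lsmul_coe, Module.Basis.coord_apply,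
      LinearMap.smul_apply, smul_eq_mul, repr_v]
    simp only [← comp_s_eq_iff]
    rcases le_or_gt (j (lo k)) (j (hi k)) with hj | hj
    · rw [op_T_s_smul_of_le hj, map_smul, Finsupp.smul_apply, repr_v, smul_eq_mul]
      split_ifs with he
      · subst he
        rw [comp_s_lo, comp_s_hi, chi_comm]
      · simp
    -- The extra term `(q - q⁻¹) v_j` does not contribute at `i`: `j` has a strict descent at `k`
    -- and `i` has none.
    · rw [v_smul_T_s, if_neg hj.not_gt, if_neg hj.ne', map_add, map_smul, map_smul,
        Finsupp.add_apply, Finsupp.smul_apply, Finsupp.smul_apply, repr_v, repr_v,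
        if_neg (show j ≠ i by rintro rfl; exact h.not_gt hj), smul_zero, add_zero, smul_eq_mul]
      split_ifs with he
      · subst he
        rw [comp_s_lo, comp_s_hi, chi, if_neg hj.ne, sgn_comm]
      · simp
  exact LinearMap.congr_fun key x

theorem matrixUnit_v (i j i' : MultiIndex m n r) :
    matrixUnit R i j (v i') = if i' = i then v j else 0 := by
  rw [← tensorBasis_apply, matrixUnit, Module.Basis.constr_basis]

/-- The matrix unit `e_{μ,λd}` commutes with the parabolic subalgebra of `W_{λd∩μ}`. -/
theorem matrixUnit_op_T_s_smul (t : Triple m n r) {k : Fin (r - 1)}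
    (hk : pairIndex t.lam t.mu t.d (lo k) = pairIndex t.lam t.mu t.d (hi k))
    (x : TensorSpace R m n r) :
    matrixUnit R (iOf t.mu) (iOf t.lam ∘ t.d) (op (T q (s k)) • x) =
      op (T q (s k)) • matrixUnit R (iOf t.mu) (iOf t.lam ∘ t.d) x := by
  obtain ⟨hmu, hlam⟩ := pairIndex_eq_iff.1 hk
  -- Equal parity makes `𝒯_{s_k}` act by the same scalar on `v_{i_μ}` and on `v_{i_λ d}`.
  have hpar := (mem_doubleRepsCirc.1 t.mem).2 _ _ (lo_lt_hi k).ne hmu hlam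
  have key : matrixUnit R (iOf t.mu) (iOf t.lam ∘ t.d) ∘ₗ
      Algebra.lsmul R R (TensorSpace R m n r) (op (T q (s k))) =
      Algebra.lsmul R R (TensorSpace R m n r) (op (T q (s k))) ∘ₗ
        matrixUnit R (iOf t.mu) (iOf t.lam ∘ t.d) := by
    refine tensorBasis.ext fun i => ?_
    rw [tensorBasis_apply]
    simp only [LinearMap.comp_apply, Algebra.lsmul_coe, matrixUnit_v]
    by_cases hi : i = iOf t.mu
    · subst hi
      rw [if_pos rfl, op_T_s_smul_of_le hmu.le, comp_s_eq hmu, map_smul, matrixUnit_v, if_pos rfl,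
        op_T_s_smul_of_le (i := iOf t.lam ∘ t.d) hlam.le,
        comp_s_eq (g := iOf t.lam ∘ t.d) hlam]
      congr 1
      simp only [chi, Function.comp_apply, if_pos hmu, if_pos hlam, hpar]
    · have h1 : i ∘ s k ≠ iOf t.mu := fun h =>
        hi (by rw [comp_s_eq_iff.1 h, comp_s_eq hmu])
      rw [if_neg hi, smul_zero, v_smul_T_s]
      split_ifs <;> simp [matrixUnit_v, hi, h1]
  exact LinearMap.congr_fun key x

variable (q) in
/-- The relative norm `N^d_{μλ}` as an endomorphism of the module over the Hecke algebra. -/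
def relNormHom (t : Triple m n r) : Module.End (Hecke q r)ᵐᵒᵖ (TensorSpace R m n r) where
  toFun := normElt q t
  map_add' := map_add _
  map_smul' h x := map_op_T_smul (normElt q t) (fun k x => relNorm_op_T_s_smul
    (monotone_pairIndex (mem_doubleRepsCirc.1 t.mem).1) (fun _ => mem_youngInter) _
    (fun _ hj x => matrixUnit_op_T_s_smul t hj x) k x) h.unop x

theorem relNormHom_apply (t : Triple m n r) (x : TensorSpace R m n r) :
    relNormHom q t x = normElt q t x := rfl

-- `𝒯_{w⁻¹}` sends `v_{i_α}` to a unit multiple of `v_{i_α w⁻¹}`, which the matrix unit kills unless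
-- `α = μ` and `w ∈ W_μ`.
open scoped Classical in
theorem normElt_v (t : Triple m n r) (al : Composition m n r) :
    normElt q t (v (iOf al)) = if al = t.mu then
      ∑ w : W r with w ∈ young t.mu ∧ w ∈ distinguished (youngInter t.lam t.mu t.d),
        coef q (iOf t.mu) w • op (T q w) • (v (iOf t.lam ∘ t.d) : TensorSpace R m n r)
      else 0 := by
  rw [normElt, relNorm_top_apply]
  simp only [op_T_smul_v_of_monotone (monotone_iOf al), map_smul, matrixUnit_v]
  split_ifs with h
  · subst h
    rw [Finset.sum_filter, Finset.sum_filter]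
    refine Finset.sum_congr rfl fun w _ => ?_
    have e1 : iOf t.mu ∘ ⇑w⁻¹ = iOf t.mu ↔ w ∈ young t.mu := by
      rw [← mem_young, inv_mem_iff]
    simp only [e1, ite_and]
    by_cases hy : w ∈ young t.mu
    · rw [if_pos hy, if_pos hy, coef_inv q (mem_young.1 hy), smul_comm]
    · simp [hy]
  · refine Finset.sum_eq_zero fun w _ => ?_
    rw [if_neg, smul_zero, smul_zero]
    intro he
    apply h
    rw [← weight_iOf al, ← weight_comp _ w⁻¹, he, weight_iOf]

variable (R q m n r) in
/-- The tensor space is generated by the `v_{i_λ}` over the Hecke algebra. -/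
theorem span_v_iOf : Submodule.span (Hecke q r)ᵐᵒᵖ
    (Set.range fun lam : Composition m n r => (v (iOf lam) : TensorSpace R m n r)) = ⊤ := by
  refine Submodule.eq_top_iff'.2 fun x => ?_
  rw [← (tensorBasis (R := R)).sum_repr x]
  refine Submodule.sum_mem _ fun i _ => Submodule.smul_of_tower_mem _ _ ?_
  rw [tensorBasis_apply]
  obtain ⟨c, hc⟩ := isUnit_coef q (iOf (weight i)) (coset i)
  have h1 := op_T_smul_v_of_monotone (R := R) (q := q) (monotone_iOf (weight i)) (coset i)
  rw [iOf_weight_comp_coset] at h1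
  have h2 : (v i : TensorSpace R m n r) =
      ((c⁻¹ : Rˣ) : R) • op (T q (coset i)) • v (iOf (weight i)) := by
    rw [h1, smul_smul, ← hc, Units.inv_mul, one_smul]
  rw [h2]
  exact Submodule.smul_of_tower_mem _ _
    (Submodule.smul_mem _ _ (Submodule.subset_span ⟨weight i, rfl⟩))

variable (q) in
/-- The coefficients of `v_{i_λ d}` in the images of the `v_{i_μ}`. -/
def tripleCoeff : Module.End (Hecke q r)ᵐᵒᵖ (TensorSpace R m n r) →ₗ[R] (Triple m n r → R) where
  toFun F t := tensorBasis.repr (F (v (iOf t.mu))) (iOf t.lam ∘ t.d)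
  map_add' F G := by
    funext t
    simp
  map_smul' a F := by
    funext t
    simp

/-- The pair sequences of the two triples are monotone and rearrangements of each other, hence
equal. -/
theorem exists_comp_of_mem {t : Triple m n r} {w : W r} (hw : w ∈ young t.mu)
    {t' : Triple m n r} (hmu : t'.mu = t.mu)
    (h : iOf t.lam ∘ t.d ∘ w = iOf t'.lam ∘ t'.d) :
    t' = t ∧ w ∈ youngInter t.lam t.mu t.d := by
  have h1 : pairIndex t.lam t.mu t.d ∘ w = pairIndex t'.lam t'.mu t'.d := by
    funext k
    have e1 : iOf t.mu (w k) = iOf t'.mu k := by rw [hmu]; exact hw k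
    have e2 : iOf t.lam (t.d (w k)) = iOf t'.lam (t'.d k) := congrFun h k
    simp only [pairIndex, Function.comp_apply, e1, e2]
  have h2 : pairIndex t.lam t.mu t.d ∘ w = pairIndex t.lam t.mu t.d := by
    have hm := monotone_pairIndex t.mem.1
    exact Tuple.unique_monotone (τ := 1) (h1 ▸ monotone_pairIndex t'.mem.1) hm
  refine ⟨Triple.eq_of_index_eq hmu ?_, mem_youngInter.2 h2⟩
  rw [← h]
  funext k
  exact (pairIndex_eq_iff.1 (congrFun h2 k)).2

-- On `v_{i_μ}`, the term of `w` in the norm is a multiple of `v_{i_λ d w}`. This is the basis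
-- vector of a triple only for `w ∈ W_ν`, and the only shortest representative in `W_ν` is `1`, with
-- coefficient `1`.
open scoped Classical in
theorem tripleCoeff_relNormHom (t : Triple m n r) :
    tripleCoeff q (relNormHom q t) = (Pi.single t 1 : Triple m n r → R) := by
  funext t'
  change tensorBasis.repr (normElt q t (v (iOf t'.mu))) (iOf t'.lam ∘ t'.d) = _
  rw [normElt_v, Pi.single_apply]
  by_cases hmu : t'.mu = t.mu
  swap
  · rw [if_neg hmu, map_zero, Finsupp.zero_apply, if_neg]
    rintro rfl
    exact hmu rfl
  have hD := mem_distinguished_iff (monotone_pairIndex t.mem.1) fun _ => mem_youngInter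
  have hv : ∀ w ∈ young t.mu, op (T q w) • (v (iOf t.lam ∘ t.d) : TensorSpace R m n r) =
      coef q (iOf t.lam ∘ t.d) w • v (iOf t.lam ∘ t.d ∘ w) := by
    intro w hw
    refine op_T_smul_v _ w fun p hp => ?_
    have he := eq_of_mem_invSet (monotone_iOf t.mu) (mem_young.1 hw) hp
    exact monotone_iOf t.lam ((mem_doubleReps.1 t.mem.1).2 _ _ (mem_invSet.1 hp).1 he).le
  have hne : ∀ w, w ∈ young t.mu → w ∈ distinguished (youngInter t.lam t.mu t.d) →
      iOf t.lam ∘ t.d ∘ w = iOf t'.lam ∘ t'.d → t' = t ∧ w = 1 := by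
    intro w hw hwD h
    obtain ⟨h1, h2⟩ := exists_comp_of_mem hw hmu h
    exact ⟨h1, ((hD w).1 hwD).eq_one (monotone_pairIndex t.mem.1) (mem_youngInter.1 h2)⟩
  rw [if_pos hmu, map_sum, Finsupp.finsetSum_apply]
  have hterm : ∀ w ∈ Finset.univ.filter fun w : W r => w ∈ young t.mu ∧
      w ∈ distinguished (youngInter t.lam t.mu t.d),
      tensorBasis.repr (coef q (iOf t.mu) w • op (T q w) •
        (v (iOf t.lam ∘ t.d) : TensorSpace R m n r)) (iOf t'.lam ∘ t'.d) =
      if w = 1 then (if t' = t then 1 else 0) else 0 := by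
    intro w hw
    rw [Finset.mem_filter] at hw
    rw [hv w hw.2.1, map_smul, map_smul, Finsupp.smul_apply, Finsupp.smul_apply, repr_v]
    by_cases he : iOf t.lam ∘ t.d ∘ w = iOf t'.lam ∘ t'.d
    · obtain ⟨rfl, rfl⟩ := hne w hw.2.1 hw.2.2 he
      simp [coef_one]
    · rw [if_neg he, smul_zero, smul_zero]
      split_ifs with h1 h2
      · subst h1 h2
        exact absurd rfl he
      · rfl
      · rfl
  rw [Finset.sum_congr rfl hterm, Finset.sum_ite_eq', if_pos]
  exact Finset.mem_filter.2 ⟨Finset.mem_univ _, one_mem _, (hD 1).2 (fibreIncr_one _)⟩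

/-- All other coefficients of `F(v_{i_μ})` are forced. One at an index not sorted on the blocks of
`μ` is a unit multiple of one at a lexicographically smaller index; one at a sorted index violating
the parity condition is killed by two different eigenvalues. -/
theorem tripleCoeff_injective [IsDomain R] (hq : (q : R) ≠ -((q⁻¹ : Rˣ) : R)) :
    Function.Injective (tripleCoeff (m := m) (n := n) (r := r) q) := by
  rw [injective_iff_map_eq_zero]
  intro F hF
  refine LinearMap.ext_on_range (span_v_iOf R q m n r) fun mu => ?_
  rw [LinearMap.zero_apply]
  refine (tensorBasis (R := R)).ext_elem fun i => ?_
  rw [map_zero, Finsupp.zero_apply]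
  -- `F` carries the eigenvector `v_{i_μ}` of `𝒯_{s_k}` to a vector on which `𝒯_{s_k}` acts by the
  -- same scalar.
  have hx : ∀ k, iOf mu (lo k) = iOf mu (hi k) → op (T q (s k)) • F (v (iOf mu)) =
      chi q (iOf mu (lo k)) (iOf mu (hi k)) • F (v (iOf mu)) := by
    intro k hk
    rw [← map_smul, op_T_s_smul_of_le hk.le, comp_s_eq hk, LinearMap.map_smul_of_tower]
  have hi' : ∀ i' : Lex (MultiIndex m n r),
      tensorBasis.repr (F (v (iOf mu))) (ofLex i') = 0 := by
    intro i'
    induction i' using WellFoundedLT.induction with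
    | ind i' ih =>
    obtain ⟨i, rfl⟩ := toLex.surjective i'
    rw [ofLex_toLex]
    by_cases hsort : ∀ a b, a < b → iOf mu a = iOf mu b → i a ≤ i b
    · have hd := coset_mem_doubleReps hsort
      have hc := iOf_weight_comp_coset i
      by_cases hcirc : coset i ∈ doubleRepsCirc (weight i) mu
      · have := congrFun hF ⟨weight i, mu, coset i, hcirc⟩
        change tensorBasis.repr (F (v (iOf mu))) (iOf (weight i) ∘ coset i) = 0 at this
        rwa [hc] at this
      · rw [mem_doubleRepsCirc] at hcirc
        have hca : ∀ a, iOf (weight i) (coset i a) = i a := fun a => congrFun hc a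
        have hbad : ∃ a b, a < b ∧ iOf mu a = iOf mu b ∧ i a = i b ∧
            ¬ (IsOdd (iOf mu a) ↔ IsOdd (i a)) := by
          by_contra! hcon
          refine hcirc ⟨hd, fun a b hab hmu h => ?_⟩
          rw [hca, hca] at h
          rw [hca]
          rcases hab.lt_or_gt with hlt | hlt
          · exact hcon a b hlt hmu h
          · rw [hmu, h]
            exact hcon b a hlt hmu.symm h.symm
        obtain ⟨a, b, hab, hmu, hiab, hpar⟩ := hbad
        have hlt := Fin.lt_def.1 hab
        have hbr := b.2
        -- Sortedness between `a` and `b` forces the right neighbour of `a` to carry the same entry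
        -- in the same block, so the clash occurs at a basic transposition.
        let k : Fin (r - 1) := ⟨a, by omega⟩
        have hk : hi k ≤ b := Fin.le_def.2 (by simp only [hi, k]; omega)
        have hmuk : iOf mu a = iOf mu (hi k) :=
          le_antisymm (monotone_iOf mu (lo_lt_hi k).le) (hmu ▸ monotone_iOf mu hk)
        have hik : i a = i (hi k) := by
          refine le_antisymm (hsort _ _ (lo_lt_hi k) hmuk) ?_
          rcases hk.eq_or_lt with h | h
          · rw [h, hiab]
          · exact hiab ▸ hsort _ _ h (hmuk.symm.trans hmu)
        have h1 := repr_op_T_s_smul (q := q) (i := i) (k := k) hik.le (F (v (iOf mu)))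
        rw [hx k hmuk, comp_s_eq hik, map_smul, Finsupp.smul_apply, smul_eq_mul, ← sub_eq_zero,
          ← sub_mul, mul_eq_zero] at h1
        -- The parities differ, so one of the two scalars is `q` and the other `-q⁻¹`.
        refine h1.resolve_left ?_
        have e1 : lo k = a := rfl
        rw [e1, chi, chi, if_pos hmuk, if_pos hik, sub_eq_zero]
        by_cases h2 : IsOdd (iOf mu a) <;> by_cases h3 : IsOdd (i a) <;>
          simp only [h2, h3, if_true, if_false, not_true, iff_self, iff_false, false_iff,
            not_false_iff] at hpar ⊢
        · exact fun h => hq h.symm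
        · exact hq
    · push Not at hsort
      obtain ⟨a, b, hab, hmu, hlt⟩ := hsort
      obtain ⟨k, hak, hkb, hk⟩ := exists_adjacent_descent i hab hlt
      have hmuk : iOf mu (lo k) = iOf mu (hi k) :=
        le_antisymm (monotone_iOf mu (lo_lt_hi k).le)
          ((monotone_iOf mu hkb).trans (hmu ▸ monotone_iOf mu hak))
      -- The exchange moves the smaller entry to the earlier place.
      have hless : toLex (i ∘ s k) < toLex i := by
        refine ⟨lo k, fun j hj => ?_, ?_⟩
        · change i (s k j) = i j
          rw [s, Equiv.swap_apply_of_ne_of_ne hj.ne (hj.trans (lo_lt_hi k)).ne]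
        · change i (s k (lo k)) < i (lo k)
          rwa [s_lo]
      have h0 : tensorBasis.repr (F (v (iOf mu))) (i ∘ s k) = 0 := ih _ hless
      have h1 := repr_op_T_s_smul (q := q) (i := i ∘ s k) (k := k)
        (by rw [comp_s_lo, comp_s_hi]; exact hk.le) (F (v (iOf mu)))
      rw [hx k hmuk, map_smul, Finsupp.smul_apply, h0, smul_zero, comp_s_comp_s] at h1
      exact (isUnit_chi q _ _).mul_right_eq_zero.1 h1.symm
  exact hi' (toLex i)

end TensorAction

/-! ### Signed symmetrisers and signs -/

section SignedElements

variable {R : Type*} [CommRing R] (q : Rˣ) {m n r : ℕ}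

theorem T'_mul_T' {lam : Composition m n r} {u w : W r} (hu : u ∈ youngEven lam)
    (hw : w ∈ youngOdd lam) : T' q u * T' q w = T' q (u * w) := by
  have hl := len_mul (monotone_evenIndex lam) (evenIndex_comp hu) (fibreIncr_evenIndex hw)
  unfold T'
  rw [smul_mul_smul_comm, T_mul_T q u w hl, ← pow_add, hl]

theorem coef_of_mem_youngEven {lam : Composition m n r} {u : W r} (hu : u ∈ youngEven lam) :
    coef q (iOf lam) u = (q : R) ^ len u := by
  rw [len_eq, ← Finset.prod_const, coef]
  refine Finset.prod_congr rfl fun p hp => ?_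
  have h1 := eq_of_mem_invSet (monotone_evenIndex lam) (evenIndex_comp hu) hp
  rcases evenIndex_eq_iff.1 h1 with h | ⟨h, h'⟩
  · exact absurd h (mem_invSet.1 hp).1.ne
  · rw [chi, if_pos h', if_neg h]

theorem coef_of_mem_youngOdd {lam : Composition m n r} {w : W r} (hw : w ∈ youngOdd lam) :
    coef q (iOf lam) w = (-((q⁻¹ : Rˣ) : R)) ^ len w := by
  rw [len_eq, ← Finset.prod_const, coef]
  refine Finset.prod_congr rfl fun p hp => ?_
  have h' := eq_of_mem_invSet (monotone_iOf lam) (mem_young.1 hw.1) hp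
  have h : IsOdd (iOf lam p.1) := by
    by_contra h
    have h1 := (fibreIncr_evenIndex hw).lt_of_mem_invSet (monotone_evenIndex lam) hp
    exact h1.ne (evenIndex_eq_iff.2 (Or.inr ⟨h, h'⟩))
  rw [chi, if_pos h', if_pos h]

/-- Each odd inversion contributes `(-q²)⁻¹` from the weight and `q` from `T'`, together `-q⁻¹`;
each even one contributes `q`. These are the values of `chi` on equal entries. -/
theorem smul_T'_even_mul_odd {lam : Composition m n r} {u w : W r} (hu : u ∈ youngEven lam)
    (hw : w ∈ youngOdd lam) : (((-q ^ 2)⁻¹ ^ len w : Rˣ) : R) • (T' q u * T' q w) =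
      coef q (iOf lam) (u * w) • T q (u * w) := by
  have hl := len_mul (monotone_evenIndex lam) (evenIndex_comp hu) (fibreIncr_evenIndex hw)
  rw [T'_mul_T' q hu hw, T', smul_smul, hl, coef_mul q (monotone_evenIndex lam)
    (evenIndex_comp hu) (fibreIncr_evenIndex hw) (mem_young.1 hu.1), coef_of_mem_youngEven q hu,
    coef_of_mem_youngOdd q hw, pow_add, mul_left_comm]
  congr 2
  have h : (((-q ^ 2)⁻¹ : Rˣ) : R) * q = -((q⁻¹ : Rˣ) : R) := by
    rw [inv_neg, Units.val_neg, neg_mul, ← Units.val_mul]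
    congr 2
    rw [pow_two, mul_inv, inv_mul_cancel_right]
  rw [Units.val_pow_eq_pow_val, ← mul_pow, h]

open scoped Classical in
theorem sum_smul_T'_even_mul_odd (lam : Composition m n r) (p : W r → Prop) :
    ∑ w : W r × W r with w.1 ∈ youngEven lam ∧ w.2 ∈ youngOdd lam ∧ p (w.1 * w.2),
      (((-q ^ 2)⁻¹ ^ len w.2 : Rˣ) : R) • (T' q w.1 * T' q w.2) =
    ∑ w : W r with w ∈ young lam ∧ p w, coef q (iOf lam) w • T q w := by
  rw [← sum_even_mul_odd lam p fun w => coef q (iOf lam) w • T q w]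
  refine Finset.sum_congr rfl fun w hw => ?_
  simp only [Finset.mem_filter] at hw
  exact smul_T'_even_mul_odd q hw.2.1 hw.2.2.1

open scoped Classical in
theorem xElt_mul_yElt (lam : Composition m n r) : xElt q lam * yElt q lam =
    ∑ w : W r with w ∈ young lam, coef q (iOf lam) w • T q w := by
  have h := sum_smul_T'_even_mul_odd q lam fun _ => True
  simp only [and_true] at h
  rw [← h, xElt, yElt, Finset.sum_mul_sum, ← Finset.sum_product', ← Finset.filter_product,
    Finset.univ_product_univ]
  exact Finset.sum_congr rfl fun w _ => mul_smul_comm _ _ _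

/-- The embedding used to verify the module axioms already contains the isomorphism: its monotone
components are the projections to the summands. -/
theorem emb_v_iOf (lam mu : Composition m n r) :
    emb q (v (iOf lam) : TensorSpace R m n r) (iOf mu) =
      if mu = lam then xElt q lam * yElt q lam else 0 := by
  classical
  have key : ∀ u, emb q (v (iOf lam) : TensorSpace R m n r) (iOf mu) u =
      if mu = lam ∧ u ∈ young lam then coef q (iOf lam) u else 0 := by
    intro u
    rw [emb_v]
    by_cases h : mu = lam
    · subst h
      simp only [monotone_iOf, true_and, mem_young]
    · rw [if_neg, if_neg (fun h' => h h'.1)]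
      rintro ⟨-, h'⟩
      exact h (by rw [← weight_iOf mu, ← weight_comp _ u, h', weight_iOf])
  rw [← sum_T q (emb q (v (iOf lam)) (iOf mu))]
  simp only [key]
  split_ifs with h
  · simp only [h, true_and]
    rw [xElt_mul_yElt, Finset.sum_filter]
    refine Finset.sum_congr rfl fun w _ => ?_
    split_ifs
    · rfl
    · rw [zero_smul]
  · simp [h]

theorem oddSign_mul_self (i : MultiIndex m n r) : oddSign R i * oddSign R i = 1 := by
  rw [oddSign, ← mul_pow, neg_one_mul, neg_neg, one_pow]

theorem mul_smul_smul_of_mul_self {M : Type*} [AddCommGroup M] [Module R M] {c : R}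
    (hc : c * c = 1) (a : R) (x : M) : (a * c) • c • x = a • x := by
  rw [smul_smul, mul_assoc, hc, mul_one]

/-- A shortest representative inverts only pairs from different blocks, where `chi` is a sign. The
bijection passes from inverted values to the places that carry them. -/
theorem coef_eq_oddSign {lam : Composition m n r} {d : W r} (hd : FibreIncr (iOf lam) d) :
    coef q (iOf lam) d = oddSign R (iOf lam ∘ d) := by
  have h1 : coef q (iOf lam) d = ∏ p ∈ invSet d,
      if IsOdd (iOf lam p.1) ∧ IsOdd (iOf lam p.2) then (-1 : R) else 1 := by
    refine Finset.prod_congr rfl fun p hp => ?_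
    rw [chi, if_neg (hd.lt_of_mem_invSet (monotone_iOf lam) hp).ne, sgn]
  rw [h1, ← Finset.prod_filter, Finset.prod_const, oddSign]
  congr 1
  refine Finset.card_bij' (fun p _ => (d⁻¹ p.2, d⁻¹ p.1)) (fun p _ => (d p.2, d p.1)) ?_ ?_ ?_ ?_
  · intro p hp
    rw [Finset.mem_filter] at hp
    simp only [Finset.mem_filter, Finset.mem_univ, true_and, Function.comp_apply, apply_inv_self']
    exact ⟨(mem_invSet.1 hp.1).2, hd.lt_of_mem_invSet (monotone_iOf lam) hp.1, hp.2.2, hp.2.1⟩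
  · intro p hp
    simp only [Finset.mem_filter, Finset.mem_univ, true_and, Function.comp_apply] at hp
    rw [Finset.mem_filter, mem_invSet, inv_apply_self', inv_apply_self']
    exact ⟨⟨(monotone_iOf lam).reflect_lt hp.2.1, hp.1⟩, hp.2.2.2, hp.2.2.1⟩
  · intro p _
    simp only [apply_inv_self']
  · intro p _
    simp only [inv_apply_self']

theorem oddSign_smul_v {lam : Composition m n r} {d : W r} (hd : FibreIncr (iOf lam) d) :
    oddSign R (iOf lam ∘ d) • (v (iOf lam ∘ d) : TensorSpace R m n r) =
      op (T q d) • v (iOf lam) := by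
  rw [op_T_smul_v_of_monotone (monotone_iOf lam), coef_eq_oddSign q hd]

end SignedElements

/-! ### The isomorphism with the signed permutation modules and the two bases -/

section Isomorphism

variable {R : Type*} [CommRing R] (q : Rˣ) {m n r : ℕ}

theorem signedOf_eq_smul (lam : Composition m n r) (h : Hecke q r) :
    signedOf q lam h = op h • signedOf q lam 1 := by
  unfold signedOf
  rw [← DirectSum.of_smul]
  congr 1
  refine Subtype.ext ?_
  change xElt q lam * yElt q lam * h = xElt q lam * yElt q lam * 1 * h
  rw [mul_one]

/-- The component of `λ` of the isomorphism onto the sum of signed `q`-permutation modules. -/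
def embHom (lam : Composition m n r) : TensorSpace R m n r →ₗ[(Hecke q r)ᵐᵒᵖ] Hecke q r where
  toFun x := emb q x (iOf lam)
  map_add' x y := by rw [map_add]; rfl
  map_smul' h x := emb_rightAct q h.unop x (iOf lam)

theorem embHom_v_iOf (lam mu : Composition m n r) :
    embHom q mu (v (iOf lam) : TensorSpace R m n r) =
      if mu = lam then xElt q lam * yElt q lam else 0 :=
  emb_v_iOf q lam mu

theorem embHom_mem (lam : Composition m n r) (x : TensorSpace R m n r) :
    embHom q lam x ∈ SignedPerm q lam := by
  have hx : x ∈ Submodule.span (Hecke q r)ᵐᵒᵖ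
      (Set.range fun lam : Composition m n r => (v (iOf lam) : TensorSpace R m n r)) := by
    rw [span_v_iOf]
    exact Submodule.mem_top
  induction hx using Submodule.span_induction with
  | mem x hx =>
    obtain ⟨mu, rfl⟩ := hx
    simp only [embHom_v_iOf]
    split_ifs with h
    · rw [h]; exact Submodule.mem_span_singleton_self _
    · exact Submodule.zero_mem _
  | zero => rw [map_zero]; exact Submodule.zero_mem _
  | add x y _ _ hx hy => rw [map_add]; exact Submodule.add_mem _ hx hy
  | smul a x _ hx => rw [map_smul]; exact Submodule.smul_mem _ _ hx

instance : Fintype (Composition m n r) := Fintype.ofFinite _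

variable (R m n r) in
/-- The map from the tensor space to the sum of signed `q`-permutation modules. -/
def toSignedTensor : TensorSpace R m n r →ₗ[(Hecke q r)ᵐᵒᵖ] SignedTensor q m n r :=
  (DirectSum.linearEquivFunOnFintype (Hecke q r)ᵐᵒᵖ (Composition m n r)
    fun lam => SignedPerm q lam).symm.toLinearMap ∘ₗ
      LinearMap.pi fun lam => (embHom q lam).codRestrict _ (embHom_mem q lam)

theorem toSignedTensor_v_iOf (lam : Composition m n r) :
    toSignedTensor R q m n r (v (iOf lam)) = signedOf q lam 1 := by
  unfold toSignedTensor
  rw [LinearMap.comp_apply, LinearEquiv.coe_coe, LinearEquiv.symm_apply_eq]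
  refine Eq.trans ?_ (DirectSum.linearEquivFunOnFintype_lof (Hecke q r)ᵐᵒᵖ lam _).symm
  funext mu
  refine Subtype.ext ?_
  change embHom q mu (v (iOf lam)) = _
  rw [embHom_v_iOf]
  split_ifs with h
  · subst h
    rw [Pi.single_eq_same]
    exact (mul_one _).symm
  · rw [Pi.single_eq_of_ne h]
    rfl

/-- No information is lost from `emb`: its components at non-monotone indices vanish, and every
monotone index is some `i_λ`. -/
theorem toSignedTensor_injective : Function.Injective (toSignedTensor R q m n r) := by
  classical
  refine (DirectSum.linearEquivFunOnFintype (Hecke q r)ᵐᵒᵖ (Composition m n r)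
    fun lam => SignedPerm q lam).symm.injective.comp ((injective_iff_map_eq_zero _).2 fun x hx => ?_)
  refine emb_injective q (funext fun j => ?_)
  rw [map_zero, Pi.zero_apply]
  by_cases hj : Monotone j
  · have h1 := congrArg Subtype.val (congrFun hx (weight j))
    change emb q x (iOf (weight j)) = 0 at h1
    rwa [iOf_weight hj] at h1
  · have key : LinearMap.proj j ∘ₗ emb q = (0 : TensorSpace R m n r →ₗ[R] Hecke q r) := by
      refine tensorBasis.ext fun i => ?_
      rw [tensorBasis_apply]
      funext u
      change emb q (v i) j u = 0
      rw [emb_v, if_neg fun h => hj h.1]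
    exact LinearMap.congr_fun key x

/-- Each summand is cyclic, generated by the image of `v_{i_λ}`. -/
theorem toSignedTensor_surjective : Function.Surjective (toSignedTensor R q m n r) := by
  rw [← LinearMap.range_eq_top, Submodule.eq_top_iff']
  intro y
  induction y using DirectSum.induction_on with
  | zero => exact Submodule.zero_mem _
  | add x y hx hy => exact Submodule.add_mem _ hx hy
  | of lam y =>
    obtain ⟨y, hy⟩ := y
    obtain ⟨a, rfl⟩ := Submodule.mem_span_singleton.1 hy
    exact ⟨a • v (iOf lam), by
      rw [map_smul, toSignedTensor_v_iOf]
      exact (signedOf_eq_smul q lam a.unop).symm⟩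

variable (R m n r) in
/-- The isomorphism between the tensor space and the sum of signed `q`-permutation modules. -/
def signedTensorEquiv : TensorSpace R m n r ≃ₗ[(Hecke q r)ᵐᵒᵖ] SignedTensor q m n r :=
  LinearEquiv.ofBijective (toSignedTensor R q m n r)
    ⟨toSignedTensor_injective q, toSignedTensor_surjective q⟩

theorem signedTensorEquiv_v_iOf (lam : Composition m n r) :
    signedTensorEquiv R q m n r (v (iOf lam)) = signedOf q lam 1 :=
  toSignedTensor_v_iOf q lam

theorem signedTensorEquiv_op_smul_v_iOf (lam : Composition m n r) (h : Hecke q r) :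
    signedTensorEquiv R q m n r (op h • v (iOf lam)) = signedOf q lam h := by
  rw [map_smul, signedTensorEquiv_v_iOf, ← signedOf_eq_smul]

theorem signedTensorEquiv_oddSign_smul {lam : Composition m n r} {d : W r}
    (hd : FibreIncr (iOf lam) d) :
    signedTensorEquiv R q m n r (oddSign R (iOf lam ∘ d) • v (iOf lam ∘ d)) =
      signedOf q lam (T q d) := by
  rw [oddSign_smul_v q hd, signedTensorEquiv_op_smul_v_iOf]

open scoped Classical in
/-- The element `∑ χ_μ(𝒯_w) 𝒯_w`, summed over `w ∈ W_μ ∩ 𝒟_ν`. -/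
def relSum (t : Triple m n r) : Hecke q r :=
  ∑ w : W r with w ∈ young t.mu ∧ w ∈ distinguished (youngInter t.lam t.mu t.d),
    coef q (iOf t.mu) w • T q w

theorem normElt_v_eq_smul (t : Triple m n r) (al : Composition m n r) :
    normElt q t (v (iOf al)) = if al = t.mu then
      oddSign R (iOf t.lam ∘ t.d) • op (T q t.d * relSum q t) • v (iOf t.lam) else 0 := by
  classical
  rw [normElt_v]
  congr 1
  have hd := oddSign_smul_v q (mem_doubleReps.1 t.mem.1).1
  have hv : (v (iOf t.lam ∘ t.d) : TensorSpace R m n r) =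
      oddSign R (iOf t.lam ∘ t.d) • op (T q t.d) • v (iOf t.lam) := by
    rw [← hd, smul_smul, oddSign_mul_self, one_smul]
  rw [op_mul_smul, ← smul_comm (op (relSum q t)) (oddSign R (iOf t.lam ∘ t.d)), ← hv]
  have : op (relSum q t) = ∑ w : W r with w ∈ young t.mu ∧
      w ∈ distinguished (youngInter t.lam t.mu t.d), coef q (iOf t.mu) w • op (T q w) :=
    map_sum (opAddEquiv (α := Hecke q r)) _ _
  rw [this, Finset.sum_smul]
  exact Finset.sum_congr rfl fun w _ => (smul_assoc _ _ _).symm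

/-- Up to the factorisation of `W_μ` into even and odd parts this is the sum in `normElt_v_eq_smul`;
the power of `q` comes from `T_d = q^{ℓ(d)} 𝒯_d`. -/
theorem doubleCosetElt_eq (t : Triple m n r) : doubleCosetElt q t.lam t.mu t.d =
    (q : R) ^ len t.d • signedOf q t.lam (T q t.d * relSum q t) := by
  classical
  let F : Hecke q r →ₗ[R] SignedTensor q m n r :=
    { toFun := signedOf q t.lam
      map_add' := fun x y => by
        rw [signedOf_eq_smul, signedOf_eq_smul q _ x, signedOf_eq_smul q _ y, op_add, add_smul]
      map_smul' := fun a x => by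
        rw [signedOf_eq_smul, signedOf_eq_smul q _ x, op_smul, smul_assoc, RingHom.id_apply] }
  have h := sum_smul_T'_even_mul_odd q t.mu
    (· ∈ distinguished (youngInter t.lam t.mu t.d))
  change doubleCosetElt q t.lam t.mu t.d = (q : R) ^ len t.d • F (T q t.d * relSum q t)
  rw [← map_smul, ← smul_mul_assoc, relSum, ← h, Finset.mul_sum, map_sum, doubleCosetElt]
  refine Finset.sum_congr rfl fun w _ => ?_
  rw [mul_smul_comm, map_smul, ← mul_assoc]
  rfl

/-- From `q² = -1`, raising to the odd power `l` gives `1 = -1`. -/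
theorem ne_neg_inv_of_isPrimitiveRoot [IsDomain R] (hR : ringChar R ≠ 2) {q : Rˣ} {l : ℕ}
    (hl : Odd l) (hq : IsPrimitiveRoot q l) : (q : R) ≠ -((q⁻¹ : Rˣ) : R) := by
  intro h
  have h1 : (q : R) ^ 2 = -1 := by
    rw [pow_two]
    nth_rewrite 2 [h]
    rw [mul_neg, Units.mul_inv]
  have h2 : (q : R) ^ l = 1 := by
    rw [← Units.val_pow_eq_pow_val, hq.pow_eq_one, Units.val_one]
  have h3 : (1 : R) = -1 := by
    rw [← hl.neg_one_pow, ← h1, ← pow_mul, mul_comm, pow_mul, h2, one_pow]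
  refine Ring.two_ne_zero hR ?_
  rw [← one_add_one_eq_two]
  nth_rewrite 1 [h3]
  exact neg_add_cancel 1

variable (m n r) in
/-- The basis of the endomorphism algebra of the tensor space formed by the relative norms. -/
def normBasis [IsDomain R] (hq : (q : R) ≠ -((q⁻¹ : Rˣ) : R)) :
    Module.Basis (Triple m n r) R (Module.End (Hecke q r)ᵐᵒᵖ (TensorSpace R m n r)) :=
  .ofEquivFun (LinearEquiv.ofBijective (tripleCoeff q) ⟨tripleCoeff_injective hq, by
    classical
    have := Fintype.ofFinite (Triple m n r)
    intro c
    refine ⟨∑ t, c t • relNormHom q t, ?_⟩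
    simp only [map_sum, map_smul, tripleCoeff_relNormHom]
    exact (pi_eq_sum_univ' c).symm⟩)

theorem normBasis_apply [IsDomain R] (hq : (q : R) ≠ -((q⁻¹ : Rˣ) : R)) (t : Triple m n r) :
    normBasis q m n r hq t = relNormHom q t := by
  classical
  rw [normBasis, Module.Basis.coe_ofEquivFun, LinearEquiv.symm_apply_eq]
  exact (tripleCoeff_relNormHom t).symm

end Isomorphism

end QSchurSuper

end

/-! ### The theorem -/

open QSchurSuper in
theorem theorem5p1 {R : Type*} [CommRing R] [IsDomain R] (hR : ringChar R ≠ 2) (q : Rˣ) (l : ℕ)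
    (hl : Odd l) (hq : IsPrimitiveRoot q l) (m n r : ℕ) :
    ∃ b : Module.Basis (Triple m n r) R (Module.End (Hecke q r)ᵐᵒᵖ (TensorSpace R m n r)),
      (∀ t, (b t).restrictScalars R = normElt q t) ∧
      ∃ f : TensorSpace R m n r ≃ₗ[(Hecke q r)ᵐᵒᵖ] SignedTensor q m n r,
        (∀ (lam : Composition m n r), ∀ d ∈ distinguished (young lam),
          f (oddSign R (iOf lam ∘ d) • v (iOf lam ∘ d)) = signedOf q lam (T q d)) ∧
        ∃ c : Module.Basis (Triple m n r) R (Module.End (Hecke q r)ᵐᵒᵖ (SignedTensor q m n r)),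
          (∀ t alpha h, c t (signedOf q alpha h) =
            if alpha = t.mu then MulOpposite.op h • doubleCosetElt q t.lam t.mu t.d else 0) ∧
          ∀ t, b t = ((q⁻¹ : Rˣ) : R) ^ len t.d • oddSign R (iOf t.lam ∘ t.d) •
            (f.symm.toLinearMap ∘ₗ c t ∘ₗ f.toLinearMap) := by
  have hq' := ne_neg_inv_of_isPrimitiveRoot hR hl hq
  let f := signedTensorEquiv R q m n r
  -- The basis of the `ψ` is the norm basis conjugated by `f` and rescaled by these units, the
  -- inverses of the factors `q^{-ℓ(d)} (-1)^{d̂}`.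
  have hunit : ∀ t : Triple m n r, IsUnit ((q : R) ^ len t.d * oddSign R (iOf t.lam ∘ t.d)) :=
    fun t => (q.isUnit.pow _).mul (.of_mul_eq_one _ (oddSign_mul_self _))
  have hf : ∀ (a : R) x, f (a • x) = a • f x := LinearMap.map_smul_of_tower f.toLinearMap
  have hf' : ∀ (a : R) x, f.symm (a • x) = a • f.symm x :=
    LinearMap.map_smul_of_tower f.symm.toLinearMap
  refine ⟨normBasis q m n r hq', fun t => ?_, f, fun lam d hd =>
    signedTensorEquiv_oddSign_smul q (mem_distinguished_young.1 hd),
    ((normBasis q m n r hq').map (f.conjAlgEquiv R).toLinearEquiv).isUnitSMul hunit,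
    fun t alpha h => ?_, fun t => ?_⟩
  · rw [normBasis_apply]
    rfl
  · rw [Module.Basis.isUnitSMul_apply, Module.Basis.map_apply, normBasis_apply, signedOf_eq_smul,
      map_smul, ← signedTensorEquiv_v_iOf]
    change MulOpposite.op h • ((q : R) ^ len t.d * oddSign R (iOf t.lam ∘ t.d)) •
      f (relNormHom q t (f.symm (f (v (iOf alpha))))) = _
    rw [LinearEquiv.symm_apply_apply, relNormHom_apply, normElt_v_eq_smul]
    split_ifs with ha
    · rw [doubleCosetElt_eq, hf, signedTensorEquiv_op_smul_v_iOf]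
      exact congrArg (MulOpposite.op h • ·) 
        (mul_smul_smul_of_mul_self (R := R) (M := SignedTensor q m n r) (oddSign_mul_self _) _ _)
    · rw [map_zero]
      exact (congrArg (MulOpposite.op h • ·) (smul_zero (A := SignedTensor q m n r)
        ((q : R) ^ len t.d * oddSign R (iOf t.lam ∘ t.d)))).trans (smul_zero _)
  · rw [Module.Basis.isUnitSMul_apply, Module.Basis.map_apply]
    refine LinearMap.ext fun x => ?_
    change _ = ((q⁻¹ : Rˣ) : R) ^ len t.d • oddSign R (iOf t.lam ∘ t.d) •
      f.symm (((q : R) ^ len t.d * oddSign R (iOf t.lam ∘ t.d)) •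
        f (normBasis q m n r hq' t (f.symm (f x))))
    rw [hf', LinearEquiv.symm_apply_apply, LinearEquiv.symm_apply_apply,
      smul_smul, smul_smul]
    have : ((q⁻¹ : Rˣ) : R) ^ len t.d * oddSign R (iOf t.lam ∘ t.d) *
        ((q : R) ^ len t.d * oddSign R (iOf t.lam ∘ t.d)) = 1 := by
      rw [mul_mul_mul_comm, oddSign_mul_self, ← mul_pow, Units.inv_mul, one_pow, one_mul]
    rw [this, one_smul]
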